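/- Write a general element of $so(5)$ (real skew-symmetric $5\times 5$ matrices) as $$\begin{pmatrix}0&x_1&a_1&a_2&b_1\\-x_1&0&a_3&a_4&b_2\\-a_1&-a_3&0&x_2&c_1\\-a_2&-a_4&-x_2&0&c_2\\-b_1&-b_2&-c_1&-c_2&0\end{pmatrix},$$ and let $\mathfrak g_e,\mathfrak g_a,\mathfrak g_b,\mathfrak g_c$ be the subspaces on which only the $x_i$, respectively only the $a_i$, $b_i$, $c_i$, may be nonzero. With $\mathbb Z_2\times\mathbb Z_2=\{e,a,b,c\}$ this is a $\mathbb Z_2\times\mathbb Z_2$-grading of $so(5)$ with $\mathfrak g_e=so(2)\oplus so(2)$. Put $\mathfrak m=\mathfrak g_a\oplus\mathfrak g_b\oplus\mathfrak g_c$ and let $\alpha_i,\beta_i,\gamma_i$ be the coordinate functions $a_i,b_i,c_i$ on $so(5)$. (1) A bilinear form $B$ on $so(5)$ is an inner product which is $\mathrm{ad}\,\mathfrak g_e$-invariant (that is, $B([Z,X],Y)+B(X,[Z,Y])=0$ for all $Z\in\mathfrak g_e$, $X,Y\in so(5)$) and for which the homogeneous components $\mathfrak g_e,\mathfrak g_a,\mathfrak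 g_b,\mathfrak g_c$ are pairwise orthogonal if and only if it is the symmetric bilinear form whose quadratic form is $$q_1+t(\alpha_1^2+\alpha_2^2+\alpha_3^2+\alpha_4^2)+u(\alpha_1\alpha_4-\alpha_2\alpha_3)+v(\beta_1^2+\beta_2^2)+w(\gamma_1^2+\gamma_2^2)$$ for some inner product $q_1$ on $\mathfrak g_e$ (evaluated on the $\mathfrak g_e$-component) and some real $t,u,v,w$ with $4t^2-u^2>0$ and $t,v,w>0$. (2) Let $B$ be such a form. Then $B|_{\mathfrak m}$ defines an adapted metric on the homogeneous space $M=SO(5)/SO(2)\times SO(2)\times SO(1)$ if and only if $u=0$ and $t=v=w$. Here adapted means: $B|_{\mathfrak m}$ is $\mathrm{Ad}(SO(2)\times SO(2)\times SO(1))$-invariant, so that it defines an $SO(5)$-invariant Riemannian metric on $M$; the symmetries of the $\mathbb Z_2\times\mathbb Z_2$-symmetric space $M$ defined by the grading are isometries of this metric; and its Levi-Civita connection is the canonical torsion-free connection $\overline\nabla_XY=\nabla_XY-\tfrac12T(X,Y)$, where $\nabla$ is the canonical connection of the reductive space $M$ (given by the $\mathfrak g_e$-component of the Maurer-Cartan form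 of $SO(5)$) and $T$ is its torsion, $T(X,Y)=-[X,Y]_{\mathfrak m}$ at the origin. -/

import Mathlib

open scoped ContDiff

noncomputable section

namespace SO5

/-! ### The group `SO(5)`, its Lie algebra and the grading -/

/-- The Lie group `SO(5)`. -/
abbrev G : Type := Matrix.specialOrthogonalGroup (Fin 5) ℝ

/-- The Lie algebra `so(5)` of skew-symmetric matrices, with the commutator bracket. -/
abbrev so5 : Type := LieAlgebra.Orthogonal.so (Fin 5) ℝ

/-- The position of an index in the block decomposition `5 = 2 + 2 + 1`, coded by an element of
`ℤ₂ × ℤ₂`. -/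
def w : Fin 5 → ZMod 2 × ZMod 2 := ![(0, 0), (0, 0), (1, 0), (1, 0), (0, 1)]

/-- The homogeneous component `g_γ` of the `ℤ₂ × ℤ₂`-grading of `so(5)`. With `e = (0, 0)`,
`a = (1, 0)`, `b = (0, 1)`, `c = (1, 1)` a general element of `so(5)` is written
```
    0    x₁   a₁   a₂   b₁
   -x₁   0    a₃   a₄   b₂
   -a₁  -a₃   0    x₂   c₁
   -a₂  -a₄  -x₂   0    c₂
   -b₁  -b₂  -c₁  -c₂   0
```
and `g_e`, `g_a`, `g_b`, `g_c` consist of the matrices in which only the `xᵢ`, respectively only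
the `aᵢ`, `bᵢ`, `cᵢ`, may be nonzero. -/
def comp (γ : ZMod 2 × ZMod 2) : Submodule ℝ so5 where
  carrier := {X | ∀ i j, w i + w j ≠ γ → X.1 i j = 0}
  add_mem' := by
    intro X Y hX hY i j h
    simp [hX i j h, hY i j h]
  zero_mem' := by simp
  smul_mem' := by
    intro c X hX i j h
    simp [hX i j h]

/-- The homogeneous part of degree `γ` of an element of `so(5)`. -/
def part (γ : ZMod 2 × ZMod 2) (X : so5) : comp γ :=
  ⟨⟨Matrix.of fun i j => if w i + w j = γ then X.1 i j else 0, by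
      have hX := (LieAlgebra.Orthogonal.mem_so (Fin 5) ℝ X.1).1 X.2
      rw [LieAlgebra.Orthogonal.mem_so]
      ext i j
      have h := congrFun (congrFun hX i) j
      simp only [Matrix.transpose_apply, Matrix.neg_apply] at h
      simp only [Matrix.transpose_apply, Matrix.neg_apply, Matrix.of_apply, add_comm (w j), h]
      split_ifs <;> simp⟩,
    fun i j h => by simp [h]⟩

/-- The complement `m = g_a ⊕ g_b ⊕ g_c` of `g_e`. -/
def m : Submodule ℝ so5 := comp (1, 0) ⊔ comp (0, 1) ⊔ comp (1, 1)

/-- The projection of `so(5) = g_e ⊕ m` onto `m`. -/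
def mPart (X : so5) : so5 := X - part 0 X

/-! ### Inner products -/

/-- A (real) inner product: a symmetric positive definite bilinear form. -/
structure IsInner {V : Type*} [AddCommGroup V] [Module ℝ V] (B : LinearMap.BilinForm ℝ V) :
    Prop where
  symm : ∀ x y, B x y = B y x
  pos : ∀ x, x ≠ 0 → 0 < B x x

/-- The homogeneous components are pairwise orthogonal. -/
def OrthogonalComponents (B : LinearMap.BilinForm ℝ so5) : Prop :=
  ∀ γ δ, γ ≠ δ → ∀ X ∈ comp γ, ∀ Y ∈ comp δ, B X Y = 0

/-- Invariance under `ad g_e`. -/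
def AdInvariant (B : LinearMap.BilinForm ℝ so5) : Prop :=
  ∀ Z ∈ comp 0, ∀ X Y, B ⁅Z, X⁆ Y + B X ⁅Z, Y⁆ = 0

/-- The coordinate functions `αᵢ`, `βᵢ`, `γᵢ` on `so(5)`: the entries `aᵢ`, `bᵢ`, `cᵢ`. -/
def α₁ (X : so5) : ℝ := X.1 0 2
/-- A coordinate function, as for `α₁`. -/
def α₂ (X : so5) : ℝ := X.1 0 3
/-- A coordinate function, as for `α₁`. -/
def α₃ (X : so5) : ℝ := X.1 1 2
/-- A coordinate function, as for `α₁`. -/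
def α₄ (X : so5) : ℝ := X.1 1 3
/-- A coordinate function, as for `α₁`. -/
def β₁ (X : so5) : ℝ := X.1 0 4
/-- A coordinate function, as for `α₁`. -/
def β₂ (X : so5) : ℝ := X.1 1 4
/-- A coordinate function, as for `α₁`. -/
def γ₁ (X : so5) : ℝ := X.1 2 4
/-- A coordinate function, as for `α₁`. -/
def γ₂ (X : so5) : ℝ := X.1 3 4

/-- The symmetric bilinear form `B` is, as a quadratic form,
`q₁ + t (α₁² + α₂² + α₃² + α₄²) + u (α₁ α₄ - α₂ α₃) + v (β₁² + β₂²) + w (γ₁² + γ₂²)`. -/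
def HasForm (B : LinearMap.BilinForm ℝ so5) (q₁ : LinearMap.BilinForm ℝ (comp 0))
    (t u v w : ℝ) : Prop :=
  (∀ X Y, B X Y = B Y X) ∧
  ∀ X, B X X = q₁ (part 0 X) (part 0 X)
    + t * (α₁ X ^ 2 + α₂ X ^ 2 + α₃ X ^ 2 + α₄ X ^ 2)
    + u * (α₁ X * α₄ X - α₂ X * α₃ X)
    + v * (β₁ X ^ 2 + β₂ X ^ 2)
    + w * (γ₁ X ^ 2 + γ₂ X ^ 2)

/-! ### The homogeneous space `M = SO(5) / SO(2) × SO(2)` -/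

theorem mul_transpose_self (g : G) : g.1 * g.1.transpose = 1 :=
  (Matrix.mem_orthogonalGroup_iff _ _).1 (Matrix.mem_specialOrthogonalGroup_iff.1 g.2).1

theorem inv_val (g : G) : (g⁻¹ : G).1 = g.1.transpose := by
  have h1 : g.1 * (g⁻¹ : G).1 = 1 := congrArg Subtype.val (mul_inv_cancel g)
  have h2 : g.1.transpose * g.1 = 1 := mul_eq_one_comm.1 (mul_transpose_self g)
  calc (g⁻¹ : G).1 = g.1.transpose * g.1 * (g⁻¹ : G).1 := by rw [h2, one_mul]
    _ = g.1.transpose := by rw [mul_assoc, h1, mul_one]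

/-- The subgroup `SO(2) × SO(2) × SO(1)` of block diagonal matrices with blocks of determinant
one. -/
def H : Subgroup G where
  carrier := {g | (∀ i j, w i ≠ w j → g.1 i j = 0) ∧
    g.1 0 0 * g.1 1 1 - g.1 0 1 * g.1 1 0 = 1 ∧
    g.1 2 2 * g.1 3 3 - g.1 2 3 * g.1 3 2 = 1 ∧ g.1 4 4 = 1}
  mul_mem' := by
    rintro g h ⟨hg, hg1, hg2, hg3⟩ ⟨hh, hh1, hh2, hh3⟩
    have e : ∀ i j, (g * h).1 i j = ∑ k, g.1 i k * h.1 k j := fun i j => Matrix.mul_apply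
    have z : ∀ i j, w i ≠ w j → (g * h).1 i j = 0 := by
      intro i j hij
      rw [e]
      refine Finset.sum_eq_zero fun k _ => ?_
      by_cases hik : w i = w k
      · rw [hh k j (hik ▸ hij), mul_zero]
      · rw [hg i k hik, zero_mul]
    refine ⟨z, ?_, ?_, ?_⟩ <;> simp only [e, Fin.sum_univ_five]
    · rw [hg 0 2 (by decide), hg 0 3 (by decide), hg 0 4 (by decide), hg 1 2 (by decide),
        hg 1 3 (by decide), hg 1 4 (by decide)]
      linear_combination (h.1 0 0 * h.1 1 1 - h.1 0 1 * h.1 1 0) * hg1 + hh1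
    · rw [hg 2 0 (by decide), hg 2 1 (by decide), hg 2 4 (by decide), hg 3 0 (by decide),
        hg 3 1 (by decide), hg 3 4 (by decide)]
      linear_combination (h.1 2 2 * h.1 3 3 - h.1 2 3 * h.1 3 2) * hg2 + hh2
    · rw [hg 4 0 (by decide), hg 4 1 (by decide), hg 4 2 (by decide), hg 4 3 (by decide), hg3, hh3]
      ring
  one_mem' := by
    refine ⟨fun i j hij => ?_, ?_, ?_, ?_⟩
    · exact Matrix.one_apply_ne fun h => hij (by rw [h])
    all_goals simp
  inv_mem' := by
    rintro g ⟨hg, hg1, hg2, hg3⟩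
    simp only [Set.mem_ofPred_eq, inv_val, Matrix.transpose_apply]
    exact ⟨fun i j hij => hg j i hij.symm, by linarith, by linarith, hg3⟩

/-- The adjoint action of `SO(5)` on `so(5)`. -/
def Ad (g : G) (X : so5) : so5 :=
  ⟨g.1 * X.1 * (g⁻¹ : G).1, by
    have hX := (LieAlgebra.Orthogonal.mem_so (Fin 5) ℝ X.1).1 X.2
    rw [LieAlgebra.Orthogonal.mem_so, inv_val]
    simp [Matrix.transpose_mul, hX, Matrix.mul_assoc]⟩

/-- The exponential map `so(5) → SO(5)`. -/
def expG (X : so5) : G :=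
  ⟨NormedSpace.exp X.1, by
    have hE : ∀ Y : so5, NormedSpace.exp Y.1 * (NormedSpace.exp Y.1).transpose = 1 := by
      intro Y
      have hY := (LieAlgebra.Orthogonal.mem_so (Fin 5) ℝ Y.1).1 Y.2
      rw [← Matrix.exp_transpose, hY, ← Matrix.exp_add_of_commute _ _ (Commute.refl Y.1).neg_right,
        add_neg_cancel, NormedSpace.exp_zero]
    have hsq : ∀ Y : so5, (NormedSpace.exp Y.1).det * (NormedSpace.exp Y.1).det = 1 := by
      intro Y
      have h := congrArg Matrix.det (hE Y)
      rwa [Matrix.det_mul, Matrix.det_transpose, Matrix.det_one] at h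
    refine Matrix.mem_specialOrthogonalGroup_iff.2
      ⟨(Matrix.mem_orthogonalGroup_iff _ _).2 (hE X), ?_⟩
    have hhalf : X.1 = ((1 / 2 : ℝ) • X).1 + ((1 / 2 : ℝ) • X).1 := by
      change X.1 = (1 / 2 : ℝ) • X.1 + (1 / 2 : ℝ) • X.1
      rw [← add_smul]; norm_num
    rw [hhalf, Matrix.exp_add_of_commute _ _ (Commute.refl _), Matrix.det_mul]
    exact hsq _⟩

/-- Smooth functions on `SO(5)`, a closed submanifold of the space of matrices: the restrictions
of smooth functions of the matrix entries. -/
def SmoothOnG (f : G → ℝ) : Prop :=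
  ∃ F : (Fin 5 → Fin 5 → ℝ) → ℝ, ContDiff ℝ ∞ F ∧ ∀ g : G, f g = F fun i j => g.1 i j

/-- Smooth functions on `M = SO(5) / H`. -/
def SmoothOnM (f : G ⧸ H → ℝ) : Prop :=
  SmoothOnG fun g => f (QuotientGroup.mk g)

/-- Vector fields on `M`. The tangent bundle of `M` is the associated bundle `G ×_H m`, where
`[g, v]` is the velocity at time `0` of the curve `s ↦ g exp (s v) H`; its smooth sections are the
smooth maps `X : G → m` with `X (g h) = Ad (h⁻¹) (X g)` for `h ∈ H`, the value at `g H` of the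
section being `[g, X g]`. -/
structure IsVectorField (X : G → so5) : Prop where
  mem : ∀ g, X g ∈ m
  smooth : ∀ i j, SmoothOnG fun g => (X g).1 i j
  equivariant : ∀ g, ∀ h ∈ H, X (g * h) = Ad h⁻¹ (X g)

/-- The derivative of a real function on `G` along the horizontal lift of a vector field `X`,
that is, at `g`, in the direction of the curve `s ↦ g exp (s X(g))`. -/
def deriv₀ (X : G → so5) (f : G → ℝ) (g : G) : ℝ :=
  deriv (fun s : ℝ => f (g * expG (s • X g))) 0

/-- The derivative `X f` of a function on `M` along a vector field, as a function on `G`. -/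
def derivM (X : G → so5) (f : G ⧸ H → ℝ) (g : G) : ℝ :=
  deriv₀ X (fun a => f (QuotientGroup.mk a)) g

/-! ### Connections on `M` -/

/-- Affine connections on `M`: maps `(X, Y) ↦ D X Y` on vector fields that are additive, linear
over smooth functions in `X` and satisfy the Leibniz rule in `Y`. -/
structure IsAffineConnection (D : (G → so5) → (G → so5) → (G → so5)) : Prop where
  isVectorField : ∀ X Y, IsVectorField X → IsVectorField Y → IsVectorField (D X Y)
  add_left : ∀ X X' Y, IsVectorField X → IsVectorField X' → IsVectorField Y →
    ∀ g, D (fun a => X a + X' a) Y g = D X Y g + D X' Y g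
  add_right : ∀ X Y Y', IsVectorField X → IsVectorField Y → IsVectorField Y' →
    ∀ g, D X (fun a => Y a + Y' a) g = D X Y g + D X Y' g
  smul_left : ∀ (f : G ⧸ H → ℝ) (X Y : G → so5), SmoothOnM f → IsVectorField X →
    IsVectorField Y → ∀ g : G, D (fun a => f (QuotientGroup.mk a) • X a) Y g
      = f (QuotientGroup.mk g) • D X Y g
  leibniz : ∀ (f : G ⧸ H → ℝ) (X Y : G → so5), SmoothOnM f → IsVectorField X →
    IsVectorField Y → ∀ g : G, D X (fun a => f (QuotientGroup.mk a) • Y a) g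
      = derivM X f g • Y g + f (QuotientGroup.mk g) • D X Y g

/-- `D` is torsion-free: `D X Y - D Y X` is the Lie bracket of the vector fields `X` and `Y`,
that is, it differentiates functions on `M` as the commutator `X Y - Y X` does. -/
def IsTorsionFree (D : (G → so5) → (G → so5) → (G → so5)) : Prop :=
  ∀ X Y, IsVectorField X → IsVectorField Y → ∀ f : G ⧸ H → ℝ, SmoothOnM f → ∀ g : G,
    derivM (fun a => D X Y a - D Y X a) f g
      = deriv₀ X (derivM Y f) g - deriv₀ Y (derivM X f) g

/-- The Riemannian metric on `M` defined by a form `B`, evaluated on two vector fields: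
`⟨[g, x], [g, y]⟩ = B x y`. -/
def metric (B : LinearMap.BilinForm ℝ so5) (X Y : G → so5) (g : G) : ℝ := B (X g) (Y g)

/-- The restriction of `B` to `m` is an `Ad H`-invariant inner product, so that `metric B` is a
well defined `G`-invariant Riemannian metric on `M`. -/
structure InducesMetric (B : LinearMap.BilinForm ℝ so5) : Prop where
  inner : IsInner (B.restrict m)
  invariant : ∀ h ∈ H, ∀ X ∈ m, ∀ Y ∈ m, B (Ad h X) (Ad h Y) = B X Y

/-- `D` is the Levi-Civita connection of the metric defined by `B`: the torsion-free affine
connection for which the metric is parallel. -/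
structure IsLeviCivita (B : LinearMap.BilinForm ℝ so5)
    (D : (G → so5) → (G → so5) → (G → so5)) : Prop where
  affine : IsAffineConnection D
  torsionFree : IsTorsionFree D
  parallel : ∀ X Y Z, IsVectorField X → IsVectorField Y → IsVectorField Z → ∀ g,
    deriv₀ X (metric B Y Z) g = metric B (D X Y) Z g + metric B Y (D X Z) g

/-- The canonical connection `∇` of the reductive space `M`, given by the `g_e`-component of the
Maurer-Cartan form of `SO(5)`: `∇_X Y` is the derivative of `Y : G → m` along the horizontal lift
of `X`, taken entry by entry. -/
def nablaCan (X Y : G → so5) (g : G) : so5 :=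
  ⟨Matrix.of fun i j => deriv₀ X (fun a => (Y a).1 i j) g, by
    rw [LieAlgebra.Orthogonal.mem_so]
    ext i j
    have h : ∀ a, (Y a).1 j i = -(Y a).1 i j := fun a =>
      congrFun (congrFun ((LieAlgebra.Orthogonal.mem_so (Fin 5) ℝ (Y a).1).1 (Y a).2) i) j
    simp only [deriv₀, Matrix.transpose_apply, Matrix.neg_apply, Matrix.of_apply, h]
    exact deriv.fun_neg⟩

/-- The torsion `T(X, Y) = -[X, Y]_m` of the canonical connection. -/
def torsionCan (X Y : G → so5) (g : G) : so5 := -mPart ⁅X g, Y g⁆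

/-- The canonical torsion-free connection, which has the same geodesics as the canonical
connection `∇`: `∇_X Y - T(X, Y) / 2`. -/
def nablaBar (X Y : G → so5) (g : G) : so5 := nablaCan X Y g - (1 / 2 : ℝ) • torsionCan X Y g

/-! ### The symmetries and adapted metrics -/

/-- The characters of `ℤ₂ × ℤ₂`. -/
def sgn (γ δ : ZMod 2 × ZMod 2) : ℝ := if γ.1 * δ.2 + γ.2 * δ.1 = 0 then 1 else -1

/-- The reflection matrix defining the automorphism `ρ_γ(g) = S_γ g S_γ` of `SO(5)`. -/
def S (γ : ZMod 2 × ZMod 2) : Matrix (Fin 5) (Fin 5) ℝ := Matrix.diagonal fun i => sgn γ (w i)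

/-- The automorphism `τ_γ` of `so(5)` induced by `ρ_γ`. It is the identity on `g_e` and `g_γ` and,
for `γ ≠ e`, minus the identity on the two other components. -/
def tau (γ : ZMod 2 × ZMod 2) (X : so5) : so5 :=
  ⟨S γ * X.1 * S γ, by
    have hX := (LieAlgebra.Orthogonal.mem_so (Fin 5) ℝ X.1).1 X.2
    rw [LieAlgebra.Orthogonal.mem_so]
    simp [S, Matrix.transpose_mul, hX, Matrix.mul_assoc]⟩

/-- All symmetries `g H ↦ g₀ ρ_γ(g₀⁻¹ g) H` of `M` are isometries of the metric defined by `B`: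
their differentials are the maps `[g, x] ↦ [g₀ ρ_γ(g₀⁻¹ g), τ_γ x]`. -/
def SymmetriesAreIsometries (B : LinearMap.BilinForm ℝ so5) : Prop :=
  ∀ γ, ∀ X ∈ m, ∀ Y ∈ m, B (tau γ X) (tau γ Y) = B X Y

/-- `B` defines an adapted metric on `M`: an invariant Riemannian metric for which the symmetries
are isometries and whose Levi-Civita connection is the canonical torsion-free connection. -/
structure IsAdapted (B : LinearMap.BilinForm ℝ so5) : Prop where
  inducesMetric : InducesMetric B
  isometries : SymmetriesAreIsometries B
  leviCivita : IsLeviCivita B nablaBar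

end SO5

end

noncomputable section
namespace SO5

/-! ### Coordinates on `so(5)` -/

/-! For (1), `g_e = so(2) ⊕ so(2)` acts on `g_b` and `g_c` by rotations of a plane, so an invariant
form there is a multiple of the standard one. On `g_a`, the space of 2×2 matrices, one factor acts
from the left and the other from the right; the invariant quadratic forms are spanned by the squared
norm and the determinant `α₁ α₄ - α₂ α₃`. The resulting form on `g_a` has eigenvalues `t ± u/2`,
whence the condition `4t² - u² > 0` together with `t > 0`. `exists_hasForm` extracts the
coefficients by testing invariance on basis vectors; the converse uses the polarized formula
`HasForm.apply`.

For (2), vector fields are equivariant maps `G → m` and the canonical connection differentiates them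
entrywise, so a form with constant coefficients is always parallel for it (`deriv₀_metric`). The
correction by half the torsion always yields a torsion-free affine connection
(`nablaBar_isAffineConnection`, `nablaBar_isTorsionFree`). Hence it is the Levi-Civita connection
exactly when its bracket term is skew for `B`, which is natural reductivity
(`isLeviCivita_nablaBar_iff`). Three triples of basis vectors then force `u = 0` and `t = v = w`.
Conversely, for these values `B` on `m` is a multiple of the trace form, and invariance and natural
reductivity follow from cyclicity of the trace. -/

theorem skew_apply (X : so5) (i j : Fin 5) : X.1 j i = -X.1 i j :=
  congrFun (congrFun ((LieAlgebra.Orthogonal.mem_so (Fin 5) ℝ X.1).1 X.2) i) j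

theorem diag_eq_zero (X : so5) (i : Fin 5) : X.1 i i = 0 := by
  linarith [skew_apply X i i]

theorem ext_so5 {X Y : so5} (h : ∀ i j, X.1 i j = Y.1 i j) : X = Y :=
  Subtype.ext (Matrix.ext h)

theorem ext_upper {X Y : so5} (h : ∀ i j, i < j → X.1 i j = Y.1 i j) : X = Y := by
  refine ext_so5 fun i j => ?_
  rcases lt_trichotomy i j with hij | rfl | hij
  · exact h i j hij
  · rw [diag_eq_zero, diag_eq_zero]
  · rw [skew_apply X j i, skew_apply Y j i, h j i hij]

@[simp] theorem add_val (X Y : so5) (i j : Fin 5) : (X + Y).1 i j = X.1 i j + Y.1 i j := rfl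
@[simp] theorem sub_val (X Y : so5) (i j : Fin 5) : (X - Y).1 i j = X.1 i j - Y.1 i j := rfl
@[simp] theorem neg_val (X : so5) (i j : Fin 5) : (-X).1 i j = -X.1 i j := rfl
@[simp] theorem smul_val (c : ℝ) (X : so5) (i j : Fin 5) : (c • X).1 i j = c * X.1 i j := rfl
@[simp] theorem zero_val (i j : Fin 5) : (0 : so5).1 i j = 0 := rfl

theorem lie_val (X Y : so5) : (⁅X, Y⁆ : so5).1 = X.1 * Y.1 - Y.1 * X.1 := rfl

theorem part_val (γ : ZMod 2 × ZMod 2) (X : so5) (i j : Fin 5) :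
    (part γ X).1.1 i j = if w i + w j = γ then X.1 i j else 0 := rfl

theorem w_add_eq_zero (i j : Fin 5) : w i + w j = 0 ↔ w i = w j := by
  revert i j; decide

theorem mPart_val (X : so5) (i j : Fin 5) :
    (mPart X).1 i j = if w i = w j then 0 else X.1 i j := by
  simp only [mPart, sub_val, part_val, w_add_eq_zero]
  split_ifs <;> simp

theorem val_eq_zero_of_mem_comp {γ : ZMod 2 × ZMod 2} (h : γ ≠ 0) {X : so5} (hX : X ∈ comp γ)
    {i j : Fin 5} (hij : w i = w j) : X.1 i j = 0 :=
  hX i j fun h' => h (h'.symm.trans ((w_add_eq_zero i j).2 hij))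

theorem mem_m {X : so5} : X ∈ m ↔ ∀ i j, w i = w j → X.1 i j = 0 := by
  constructor
  · intro hX i j hij
    obtain ⟨Y, hY, Z, hZ, rfl⟩ := Submodule.mem_sup.1 hX
    obtain ⟨Y, hYa, Y', hYb, rfl⟩ := Submodule.mem_sup.1 hY
    rw [add_val, add_val, val_eq_zero_of_mem_comp (γ := (1, 0)) (by decide) hYa hij,
      val_eq_zero_of_mem_comp (γ := (0, 1)) (by decide) hYb hij,
      val_eq_zero_of_mem_comp (γ := (1, 1)) (by decide) hZ hij]
    simp
  · intro hX
    have h : X = (part (1, 0) X).1 + (part (0, 1) X).1 + (part (1, 1) X).1 := by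
      refine ext_so5 fun i j => ?_
      simp only [add_val, part_val]
      by_cases hij : w i = w j
      · simp [hX i j hij]
      · have key : ∀ δ : ZMod 2 × ZMod 2, δ ≠ 0 → δ = (1, 0) ∨ δ = (0, 1) ∨ δ = (1, 1) := by
          decide
        rcases key _ (mt (w_add_eq_zero i j).1 hij) with h | h | h <;> rw [h] <;> simp
    rw [h]
    exact Submodule.add_mem_sup (Submodule.add_mem_sup (part _ X).2 (part _ X).2) (part _ X).2

theorem mPart_mem (X : so5) : mPart X ∈ m :=
  mem_m.2 fun i j h => by rw [mPart_val, if_pos h]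

theorem mPart_eq_self {X : so5} (hX : X ∈ m) : mPart X = X :=
  ext_so5 fun i j => by
    rw [mPart_val]
    split_ifs with h
    · rw [mem_m.1 hX i j h]
    · rfl

theorem part_zero_of_mem_m {X : so5} (hX : X ∈ m) : part 0 X = 0 :=
  Subtype.ext (ext_so5 fun i j => by
    rw [part_val]
    split_ifs with h
    · exact mem_m.1 hX i j ((w_add_eq_zero i j).1 h)
    · rfl)

theorem part_add (X Y : so5) : part 0 (X + Y) = part 0 X + part 0 Y :=
  Subtype.ext (ext_so5 fun i j => by
    rw [Submodule.coe_add, add_val, part_val, part_val, part_val]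
    split_ifs <;> simp)

/-- The skew-symmetric matrix with entry `1` at `(i, j)` and `-1` at `(j, i)`, for `i ≠ j`. -/
def skewUnit (i j : Fin 5) : so5 :=
  ⟨Matrix.single i j 1 - Matrix.single j i 1, by
    rw [LieAlgebra.Orthogonal.mem_so]
    simp⟩

theorem skewUnit_val (i j k l : Fin 5) :
    (skewUnit i j).1 k l = (if i = k ∧ j = l then 1 else 0) - if j = k ∧ i = l then 1 else 0 := by
  simp [skewUnit, Matrix.single_apply]

theorem lie_skewUnit (i j k l : Fin 5) : (⁅skewUnit i j, skewUnit k l⁆ : so5) =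
    (if j = k then skewUnit i l else 0) - (if j = l then skewUnit i k else 0)
      - (if i = k then skewUnit j l else 0) + if i = l then skewUnit j k else 0 := by
  refine Subtype.ext ?_
  have h : ∀ (p : Prop) [Decidable p] (X : so5),
      ((if p then X else 0 : so5) : Matrix (Fin 5) (Fin 5) ℝ) = if p then X.1 else 0 := by
    intro p _ X; split_ifs <;> rfl
  have hs : ∀ a b c d : Fin 5, Matrix.single a b (1 : ℝ) * Matrix.single c d 1
      = if b = c then Matrix.single a d 1 else 0 := by
    intro a b c d
    split_ifs with hbc
    · subst hbc; simp
    · simp [hbc]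
  have ha : ∀ X Y : so5, (X + Y).1 = X.1 + Y.1 := fun _ _ => rfl
  have hb : ∀ X Y : so5, (X - Y).1 = X.1 - Y.1 := fun _ _ => rfl
  rw [lie_val]
  simp only [ha, hb, h]
  simp only [skewUnit, mul_sub, sub_mul, hs, eq_comm (a := k), eq_comm (a := l)]
  split_ifs <;> abel

/-- The sum runs over ordered pairs, so each basis vector occurs twice up to sign; this accounts for
the factor one half. -/
theorem sum_skewUnit (X : so5) : X = ∑ i, ∑ j, (X.1 i j / 2) • skewUnit i j := by
  have hc : ∀ f : Fin 5 → so5, ∀ k l, (∑ i, f i).1 k l = ∑ i, (f i).1 k l := by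
    intro f k l
    simp [Fin.sum_univ_five]
  refine ext_so5 fun k l => ?_
  simp only [hc, smul_val, skewUnit_val, mul_sub, Finset.sum_sub_distrib, ite_and, mul_ite,
    mul_one, mul_zero, Finset.sum_ite_eq', Finset.mem_univ, if_true, Finset.sum_ite_irrel,
    Finset.sum_const_zero]
  simp [skew_apply X k l]
  ring

theorem mem_skewUnit (i j : Fin 5) : skewUnit i j ∈ comp (w i + w j) := by
  intro k l h
  rw [skewUnit_val, if_neg, if_neg, sub_zero]
  · rintro ⟨rfl, rfl⟩; exact h (add_comm _ _)
  · rintro ⟨rfl, rfl⟩; exact h rfl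

theorem upper_decomposition (X : so5) : X = (part 0 X).1
    + (α₁ X • skewUnit 0 2 + α₂ X • skewUnit 0 3 + α₃ X • skewUnit 1 2 + α₄ X • skewUnit 1 3)
    + (β₁ X • skewUnit 0 4 + β₂ X • skewUnit 1 4)
    + (γ₁ X • skewUnit 2 4 + γ₂ X • skewUnit 3 4) := by
  refine ext_upper fun i j h => ?_
  simp only [add_val, smul_val, skewUnit_val, part_val, α₁, α₂, α₃, α₄, β₁, β₂, γ₁, γ₂,
    w_add_eq_zero]
  fin_cases i <;> fin_cases j <;> first | (exfalso; revert h; decide) | simp [w]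

/-! ### The adjoint action -/

theorem Ad_val (g : G) (X : so5) : (Ad g X).1 = g.1 * X.1 * g.1.transpose := by
  rw [← inv_val]; rfl

theorem Ad_apply (g : G) (X : so5) (i j : Fin 5) :
    (Ad g X).1 i j = ∑ l, ∑ k, g.1 i k * X.1 k l * g.1 j l := by
  simp [Ad_val, Matrix.mul_apply, Finset.sum_mul]

theorem Ad_mul (g h : G) (X : so5) : Ad (g * h) X = Ad g (Ad h X) := by
  refine Subtype.ext ?_
  simp [Ad_val, Matrix.mul_assoc]

theorem transpose_mul_self (g : G) : g.1.transpose * g.1 = 1 :=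
  mul_eq_one_comm.1 (mul_transpose_self g)

theorem Ad_lie (g : G) (X Y : so5) : Ad g ⁅X, Y⁆ = ⁅Ad g X, Ad g Y⁆ := by
  refine Subtype.ext ?_
  have h : ∀ A B : Matrix (Fin 5) (Fin 5) ℝ,
      g.1 * A * g.1.transpose * (g.1 * B * g.1.transpose) = g.1 * (A * B) * g.1.transpose := by
    intro A B
    calc _ = g.1 * A * (g.1.transpose * g.1) * B * g.1.transpose := by simp only [Matrix.mul_assoc]
      _ = _ := by rw [transpose_mul_self, Matrix.mul_one]; simp only [Matrix.mul_assoc]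
  simp only [lie_val, Ad_val, h, mul_sub, sub_mul]

theorem Ad_add (g : G) (X Y : so5) : Ad g (X + Y) = Ad g X + Ad g Y :=
  Subtype.ext (by simp [Ad_val, mul_add, add_mul])

theorem Ad_smul (g : G) (c : ℝ) (X : so5) : Ad g (c • X) = c • Ad g X :=
  Subtype.ext (by simp [Ad_val])

/-- Conjugation by a block diagonal matrix sends each block of `X` to the same block, so it commutes
with deleting the diagonal blocks. -/
theorem Ad_mPart {h : G} (hh : h ∈ H) (X : so5) : Ad h (mPart X) = mPart (Ad h X) := by
  refine ext_so5 fun i j => ?_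
  rw [mPart_val, Ad_apply, Ad_apply]
  by_cases hij : w i = w j
  · rw [if_pos hij]
    refine Finset.sum_eq_zero fun l _ => Finset.sum_eq_zero fun k _ => ?_
    by_cases hik : w i = w k
    · by_cases hjl : w j = w l
      · rw [mPart_val, if_pos (hik.symm.trans (hij.trans hjl)), mul_zero, zero_mul]
      · rw [hh.1 j l hjl, mul_zero]
    · rw [hh.1 i k hik, zero_mul, zero_mul]
  · rw [if_neg hij]
    refine Finset.sum_congr rfl fun l _ => Finset.sum_congr rfl fun k _ => ?_
    by_cases hik : w i = w k
    · by_cases hjl : w j = w l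
      · rw [mPart_val, if_neg fun h' => hij (hik.trans (h'.trans hjl.symm))]
      · rw [hh.1 j l hjl, mul_zero, mul_zero]
    · rw [hh.1 i k hik, zero_mul, zero_mul, zero_mul, zero_mul]

theorem Ad_mem {h : G} (hh : h ∈ H) {X : so5} (hX : X ∈ m) : Ad h X ∈ m := by
  rw [← mPart_eq_self hX, Ad_mPart hh]
  exact mPart_mem _

/-! ### Invariant inner products -/

theorem IsInner.apply_self_nonneg {V : Type*} [AddCommGroup V] [Module ℝ V] {B : LinearMap.BilinForm ℝ V}
    (hB : IsInner B) (x : V) : 0 ≤ B x x := by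
  by_cases h : x = 0
  · simp [h]
  · exact (hB.pos x h).le

/-- Polarization: symmetry of `B` and `q₁` recovers the bilinear form from its values on the
diagonal. -/
theorem HasForm.apply {B : LinearMap.BilinForm ℝ so5} {q₁ : LinearMap.BilinForm ℝ (comp 0)}
    {t u v w : ℝ} (h : HasForm B q₁ t u v w) (hq : IsInner q₁) (X Y : so5) :
    B X Y = q₁ (part 0 X) (part 0 Y)
      + t * (α₁ X * α₁ Y + α₂ X * α₂ Y + α₃ X * α₃ Y + α₄ X * α₄ Y)
      + u / 2 * (α₁ X * α₄ Y + α₁ Y * α₄ X - α₂ X * α₃ Y - α₂ Y * α₃ X)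
      + v * (β₁ X * β₁ Y + β₂ X * β₂ Y)
      + w * (γ₁ X * γ₁ Y + γ₂ X * γ₂ Y) := by
  have h1 := h.2 (X + Y)
  rw [part_add] at h1
  simp only [map_add, LinearMap.add_apply, h.2 X, h.2 Y, h.1 Y X, hq.symm (part 0 Y) (part 0 X),
    α₁, α₂, α₃, α₄, β₁, β₂, γ₁, γ₂, add_val] at h1 ⊢
  linear_combination h1 / 2

theorem quadratic_nonneg {t u : ℝ} (htu : 0 < 4 * t ^ 2 - u ^ 2) (ht : 0 < t) (x y : ℝ) :
    0 ≤ t * (x ^ 2 + y ^ 2) + u * (x * y) := by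
  -- Completing the square: the right-hand side is `(2tx + uy)² + (4t² - u²)y²`.
  have h : 0 ≤ 4 * t * (t * (x ^ 2 + y ^ 2) + u * (x * y)) := by
    nlinarith [sq_nonneg (2 * t * x + u * y), mul_nonneg htu.le (sq_nonneg y)]
  exact nonneg_of_mul_nonneg_right h (by linarith)

theorem eq_zero_of_quadratic {t u : ℝ} (htu : 0 < 4 * t ^ 2 - u ^ 2) {x y : ℝ}
    (h : t * (x ^ 2 + y ^ 2) + u * (x * y) ≤ 0) (ht : 0 < t) : x = 0 ∧ y = 0 := by
  have hx : (4 * t ^ 2 - u ^ 2) * x ^ 2 ≤ 0 := by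
    nlinarith [sq_nonneg (2 * t * y + u * x), mul_nonpos_of_nonneg_of_nonpos ht.le h]
  have hy : (4 * t ^ 2 - u ^ 2) * y ^ 2 ≤ 0 := by
    nlinarith [sq_nonneg (2 * t * x + u * y), mul_nonpos_of_nonneg_of_nonpos ht.le h]
  constructor <;> by_contra h0
  · exact absurd hx (not_le.2 (by positivity))
  · exact absurd hy (not_le.2 (by positivity))

theorem HasForm.isInner {B : LinearMap.BilinForm ℝ so5} {q₁ : LinearMap.BilinForm ℝ (comp 0)}
    {t u v w : ℝ} (h : HasForm B q₁ t u v w) (hq : IsInner q₁) (htu : 0 < 4 * t ^ 2 - u ^ 2)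
    (ht : 0 < t) (hv : 0 < v) (hw : 0 < w) : IsInner B := by
  refine ⟨h.1, fun X hX => ?_⟩
  by_contra! hneg
  rw [h.2] at hneg
  have h1 := hq.apply_self_nonneg (part 0 X)
  -- The form on `g_a` is the sum of one and the same binary form at `(α₁, α₄)` and at `(α₂, -α₃)`.
  have h2 := quadratic_nonneg htu ht (α₁ X) (α₄ X)
  have h3 := quadratic_nonneg htu ht (α₂ X) (-α₃ X)
  have h4 : 0 ≤ v * β₁ X ^ 2 := by positivity
  have h5 : 0 ≤ v * β₂ X ^ 2 := by positivity
  have h6 : 0 ≤ w * γ₁ X ^ 2 := by positivity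
  have h7 : 0 ≤ w * γ₂ X ^ 2 := by positivity
  obtain ⟨a1, a4⟩ := eq_zero_of_quadratic htu (x := α₁ X) (y := α₄ X) (by linarith) ht
  obtain ⟨a2, a3⟩ := eq_zero_of_quadratic htu (x := α₂ X) (y := -α₃ X) (by linarith) ht
  have sq_zero : ∀ {c x : ℝ}, 0 < c → c * x ^ 2 ≤ 0 → x = 0 := by
    intro c x hc hx
    by_contra hx0
    exact absurd hx (not_le.2 (by positivity))
  have b1 : β₁ X = 0 := sq_zero hv (by linarith)
  have b2 : β₂ X = 0 := sq_zero hv (by linarith)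
  have c1 : γ₁ X = 0 := sq_zero hw (by linarith)
  have c2 : γ₂ X = 0 := sq_zero hw (by linarith)
  have x0 : part 0 X = 0 := by
    by_contra hx0
    linarith [hq.pos _ hx0]
  refine hX ?_
  rw [upper_decomposition X, x0, a1, a2, neg_eq_zero.1 a3, a4, b1, b2, c1, c2]
  simp

theorem HasForm.orthogonalComponents {B : LinearMap.BilinForm ℝ so5}
    {q₁ : LinearMap.BilinForm ℝ (comp 0)} {t u v w : ℝ} (h : HasForm B q₁ t u v w)
    (hq : IsInner q₁) : OrthogonalComponents B := by
  intro γ δ hne X hX Y hY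
  -- Outside `q₁`, the polarized form only couples entries of equal degree, and for such entries one
  -- factor vanishes.
  have key : ∀ i j k l, SO5.w i + SO5.w j = SO5.w k + SO5.w l → X.1 i j * Y.1 k l = 0 := by
    intro i j k l hijkl
    by_cases hγ : SO5.w i + SO5.w j = γ
    · rw [hY k l fun h' => hne (hγ.symm.trans (hijkl.trans h')), mul_zero]
    · rw [hX i j hγ, zero_mul]
  have hp : ∀ {ε : ZMod 2 × ZMod 2} {Z : so5}, Z ∈ comp ε → ε ≠ 0 → part 0 Z = 0 := by
    intro ε Z hZ hε
    refine Subtype.ext (ext_so5 fun i j => ?_)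
    rw [part_val]
    split_ifs with hij
    · exact hZ i j fun h' => hε (h'.symm.trans hij)
    · rfl
  have h0 : q₁ (part 0 X) (part 0 Y) = 0 := by
    by_cases hγ : γ = 0
    · rw [hp hY fun hδ => hne (hγ.trans hδ.symm), map_zero]
    · rw [hp hX hγ, map_zero, LinearMap.zero_apply]
  rw [h.apply hq, h0]
  simp only [α₁, α₂, α₃, α₄, β₁, β₂, γ₁, γ₂]
  linear_combination t * (key 0 2 0 2 rfl + key 0 3 0 3 rfl + key 1 2 1 2 rfl + key 1 3 1 3 rfl)
    + u / 2 * (key 0 2 1 3 rfl + key 1 3 0 2 rfl - key 0 3 1 2 rfl - key 1 2 0 3 rfl)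
    + v * (key 0 4 0 4 rfl + key 1 4 1 4 rfl) + w * (key 2 4 2 4 rfl + key 3 4 3 4 rfl)

/-- The infinitesimal rotations by which `g_e` acts on `m`. The `g_e`-part of the bracket vanishes
because `g_e` is abelian and preserves degrees. -/
theorem lie_apply_of_mem_comp_zero {Z : so5} (hZ : Z ∈ comp 0) (X : so5) :
    part 0 ⁅Z, X⁆ = 0 ∧
    α₁ ⁅Z, X⁆ = Z.1 0 1 * α₃ X + Z.1 2 3 * α₂ X ∧ α₂ ⁅Z, X⁆ = Z.1 0 1 * α₄ X - Z.1 2 3 * α₁ X ∧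
    α₃ ⁅Z, X⁆ = -Z.1 0 1 * α₁ X + Z.1 2 3 * α₄ X ∧
    α₄ ⁅Z, X⁆ = -Z.1 0 1 * α₂ X - Z.1 2 3 * α₃ X ∧
    β₁ ⁅Z, X⁆ = Z.1 0 1 * β₂ X ∧ β₂ ⁅Z, X⁆ = -Z.1 0 1 * β₁ X ∧
    γ₁ ⁅Z, X⁆ = Z.1 2 3 * γ₂ X ∧ γ₂ ⁅Z, X⁆ = -Z.1 2 3 * γ₁ X := by
  have e : ∀ i j, (⁅Z, X⁆ : so5).1 i j = ∑ k, (Z.1 i k * X.1 k j - X.1 i k * Z.1 k j) := by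
    intro i j
    rw [lie_val, Matrix.sub_apply, Matrix.mul_apply, Matrix.mul_apply, Finset.sum_sub_distrib]
  have z : ∀ i j, w i ≠ w j → Z.1 i j = 0 := fun i j h =>
    hZ i j fun h' => h ((w_add_eq_zero i j).1 h')
  have s1 := skew_apply Z 0 1
  have s2 := skew_apply Z 2 3
  refine ⟨Subtype.ext (ext_upper fun i j hij => ?_), ?_⟩
  · rw [part_val]
    split_ifs with h
    · rw [w_add_eq_zero] at h
      have : (i = 0 ∧ j = 1) ∨ (i = 2 ∧ j = 3) := by revert i j; decide
      rcases this with ⟨rfl, rfl⟩ | ⟨rfl, rfl⟩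
      · rw [e, Fin.sum_univ_five, z 0 2 (by decide), z 0 3 (by decide), z 0 4 (by decide),
          z 2 1 (by decide), z 3 1 (by decide), z 4 1 (by decide)]
        simp [diag_eq_zero]
      · rw [e, Fin.sum_univ_five, z 2 0 (by decide), z 2 1 (by decide), z 2 4 (by decide),
          z 0 3 (by decide), z 1 3 (by decide), z 4 3 (by decide)]
        simp [diag_eq_zero]
    · rfl
  · have z02 := z 0 2 (by decide)
    have z03 := z 0 3 (by decide)
    have z04 := z 0 4 (by decide)
    have z12 := z 1 2 (by decide)
    have z13 := z 1 3 (by decide)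
    have z14 := z 1 4 (by decide)
    have z20 := z 2 0 (by decide)
    have z21 := z 2 1 (by decide)
    have z24 := z 2 4 (by decide)
    have z30 := z 3 0 (by decide)
    have z31 := z 3 1 (by decide)
    have z34 := z 3 4 (by decide)
    have z42 := z 4 2 (by decide)
    have z43 := z 4 3 (by decide)
    simp only [α₁, α₂, α₃, α₄, β₁, β₂, γ₁, γ₂, e, Fin.sum_univ_five, s1, s2, diag_eq_zero, z02,
      z03, z04, z12, z13, z14, z20, z21, z24, z30, z31, z34, z42, z43]
    refine ⟨?_, ?_, ?_, ?_, ?_, ?_, ?_, ?_⟩ <;> ring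

theorem HasForm.adInvariant {B : LinearMap.BilinForm ℝ so5}
    {q₁ : LinearMap.BilinForm ℝ (comp 0)} {t u v w : ℝ} (h : HasForm B q₁ t u v w)
    (hq : IsInner q₁) : AdInvariant B := by
  intro Z hZ X Y
  obtain ⟨x0, x1, x2, x3, x4, x5, x6, x7, x8⟩ := lie_apply_of_mem_comp_zero hZ X
  obtain ⟨y0, y1, y2, y3, y4, y5, y6, y7, y8⟩ := lie_apply_of_mem_comp_zero hZ Y
  rw [h.apply hq, h.apply hq, x0, x1, x2, x3, x4, x5, x6, x7, x8, y0, y1, y2, y3, y4, y5, y6, y7,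
    y8, map_zero, map_zero, LinearMap.zero_apply]
  ring

theorem apply_two {V : Type*} [AddCommGroup V] [Module ℝ V] {B : LinearMap.BilinForm ℝ V}
    (hB : IsInner B) {e f : V} {v : ℝ} (h1 : B e e = v) (h2 : B f f = v) (h3 : B e f = 0)
    (x y : ℝ) : B (x • e + y • f) (x • e + y • f) = v * (x ^ 2 + y ^ 2) := by
  simp only [map_add, map_smul, LinearMap.add_apply, LinearMap.smul_apply, smul_eq_mul, h1, h2, h3,
    hB.symm f e]
  ring

/-- The hypotheses are the Gram matrix which invariance forces on `g_a`; the coefficient `u` is `2 *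
z`. -/
theorem apply_four {V : Type*} [AddCommGroup V] [Module ℝ V] {B : LinearMap.BilinForm ℝ V}
    (hB : IsInner B) {e f g h : V} {t z : ℝ} (h1 : B e e = t) (h2 : B f f = t) (h3 : B g g = t)
    (h4 : B h h = t) (h5 : B e f = 0) (h6 : B e g = 0) (h7 : B e h = z) (h8 : B f g = -z)
    (h9 : B f h = 0) (h10 : B g h = 0) (x y p q : ℝ) :
    B (x • e + y • f + p • g + q • h) (x • e + y • f + p • g + q • h)
      = t * (x ^ 2 + y ^ 2 + p ^ 2 + q ^ 2) + 2 * z * (x * q - y * p) := by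
  simp only [map_add, map_smul, LinearMap.add_apply, LinearMap.smul_apply, smul_eq_mul, h1, h2, h3,
    h4, h5, h6, h7, h8, h9, h10, hB.symm f e, hB.symm g e, hB.symm h e, hB.symm g f, hB.symm h f,
    hB.symm h g]
  ring

theorem exists_hasForm {B : LinearMap.BilinForm ℝ so5} (hB : IsInner B)
    (ho : OrthogonalComponents B) (ha : AdInvariant B) :
    ∃ (q₁ : LinearMap.BilinForm ℝ (comp 0)) (t u v w : ℝ),
      IsInner q₁ ∧ 0 < 4 * t ^ 2 - u ^ 2 ∧ 0 < t ∧ 0 < v ∧ 0 < w ∧ HasForm B q₁ t u v w := by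
  have ne : ∀ i j, i < j → skewUnit i j ≠ 0 := by
    intro i j hij h
    have := congrArg (fun X : so5 => X.1 i j) h
    simp [skewUnit_val, hij.ne, hij.ne'] at this
  have ht := hB.pos _ (ne 0 2 (by decide))
  have hv := hB.pos _ (ne 0 4 (by decide))
  have hw := hB.pos _ (ne 2 4 (by decide))
  have r1 := fun i j k l => ha (skewUnit 0 1) (mem_skewUnit 0 1) (skewUnit i j) (skewUnit k l)
  have r2 := fun i j k l => ha (skewUnit 2 3) (mem_skewUnit 2 3) (skewUnit i j) (skewUnit k l)
  -- Brackets of basis vectors may come out with reversed indices; this brings them back to `i < j`.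
  have flip : ∀ i j, skewUnit i j = -skewUnit j i := by
    intro i j
    refine Subtype.ext ?_
    change _ = -(skewUnit j i).1
    simp [skewUnit]
  have f1 := flip 2 0
  have f2 := flip 3 0
  have f3 := flip 2 1
  have f4 := flip 3 1
  simp only [lie_skewUnit] at r1 r2
  have s := fun i j k l => hB.symm (skewUnit i j) (skewUnit k l)
  have p1 := r1 0 2 1 2
  have p2 := r1 0 3 1 3
  have p3 := r1 0 2 0 2
  have p4 := r1 0 3 0 3
  have p5 := r1 0 2 1 3
  have p6 := r1 0 2 0 3
  have p7 := r1 0 4 1 4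
  have p8 := r1 0 4 0 4
  have o1 := r2 0 2 0 3
  have o2 := r2 1 2 1 3
  have o3 := r2 0 2 0 2
  have o4 := r2 1 2 1 2
  have o5 := r2 0 2 1 2
  have o6 := r2 0 2 1 3
  have o7 := r2 2 4 3 4
  have o8 := r2 2 4 2 4
  simp [f1, f2, f3, f4] at p1 p2 p3 p4 p5 p6 p7 p8 o1 o2 o3 o4 o5 o6 o7 o8
  have s1 := s 1 2 0 2
  have s2 := s 1 3 0 3
  have s3 := s 0 3 0 2
  have s4 := s 1 3 1 2
  have s5 := s 1 2 0 3
  have s6 := s 1 3 0 2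
  have s7 := s 1 4 0 4
  have s8 := s 3 4 2 4
  -- The vectors `skewUnit 0 2 ± skewUnit 1 3` are eigendirections of the form on `g_a`. Positivity
  -- on both gives `t ± u/2 > 0`, and the product of these inequalities is the discriminant
  -- condition.
  have hpos : ∀ c : ℝ, c * c = 1 →
      0 < B (skewUnit 0 2) (skewUnit 0 2) + c * B (skewUnit 0 2) (skewUnit 1 3) := by
    intro c hc
    have hne : skewUnit 0 2 + c • skewUnit 1 3 ≠ 0 := by
      intro h
      have := congrArg (fun X : so5 => X.1 0 2) h
      simp [skewUnit_val] at this
    have h := hB.pos _ hne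
    simp only [map_add, map_smul, LinearMap.add_apply, LinearMap.smul_apply, smul_eq_mul] at h
    have h' : c * (c * B (skewUnit 1 3) (skewUnit 1 3)) = B (skewUnit 0 2) (skewUnit 0 2) := by
      linear_combination B (skewUnit 1 3) (skewUnit 1 3) * hc - p1 - o2
    rw [s6] at h
    linarith
  refine ⟨B.restrict (comp 0), B (skewUnit 0 2) (skewUnit 0 2),
    2 * B (skewUnit 0 2) (skewUnit 1 3), B (skewUnit 0 4) (skewUnit 0 4),
    B (skewUnit 2 4) (skewUnit 2 4), ⟨fun x y => hB.symm x y, fun x hx => hB.pos x ?_⟩, ?_, ht, hv,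
    hw, hB.symm, fun X => ?_⟩
  · simpa using hx
  · nlinarith [mul_pos (hpos 1 (by norm_num)) (hpos (-1) (by norm_num))]
  · have mem_a : α₁ X • skewUnit 0 2 + α₂ X • skewUnit 0 3 + α₃ X • skewUnit 1 2
        + α₄ X • skewUnit 1 3 ∈ comp (1, 0) :=
      add_mem (add_mem (add_mem (Submodule.smul_mem _ _ (mem_skewUnit 0 2))
        (Submodule.smul_mem _ _ (mem_skewUnit 0 3))) (Submodule.smul_mem _ _ (mem_skewUnit 1 2)))
        (Submodule.smul_mem _ _ (mem_skewUnit 1 3))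
    have mem_b : β₁ X • skewUnit 0 4 + β₂ X • skewUnit 1 4 ∈ comp (0, 1) :=
      add_mem (Submodule.smul_mem _ _ (mem_skewUnit 0 4))
        (Submodule.smul_mem _ _ (mem_skewUnit 1 4))
    have mem_c : γ₁ X • skewUnit 2 4 + γ₂ X • skewUnit 3 4 ∈ comp (1, 1) :=
      add_mem (Submodule.smul_mem _ _ (mem_skewUnit 2 4))
        (Submodule.smul_mem _ _ (mem_skewUnit 3 4))
    have mem_e := (part 0 X).2
    have pythagoras : ∀ P A C D : so5, P ∈ comp 0 → A ∈ comp (1, 0) → C ∈ comp (0, 1) →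
        D ∈ comp (1, 1) → B (P + A + C + D) (P + A + C + D) = B P P + B A A + B C C + B D D := by
      intro P A C D hP hA hC hD
      simp only [map_add, LinearMap.add_apply, ho 0 (1, 0) (by decide) P hP A hA,
        ho 0 (0, 1) (by decide) P hP C hC, ho 0 (1, 1) (by decide) P hP D hD,
        ho (1, 0) 0 (by decide) A hA P hP, ho (1, 0) (0, 1) (by decide) A hA C hC,
        ho (1, 0) (1, 1) (by decide) A hA D hD, ho (0, 1) 0 (by decide) C hC P hP,
        ho (0, 1) (1, 0) (by decide) C hC A hA, ho (0, 1) (1, 1) (by decide) C hC D hD,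
        ho (1, 1) 0 (by decide) D hD P hP, ho (1, 1) (1, 0) (by decide) D hD A hA,
        ho (1, 1) (0, 1) (by decide) D hD C hC]
      ring
    conv_lhs => rw [upper_decomposition X]
    rw [pythagoras _ _ _ _ mem_e mem_a mem_b mem_c,
      apply_two hB rfl (by linarith) (by linarith), apply_two hB rfl (by linarith) (by linarith),
      apply_four hB rfl (by linarith) (by linarith) (by linarith) (by linarith) (by linarith) rfl
        (by linarith) (by linarith) (by linarith), ← add_assoc]
    rfl

/-! ### Smooth functions on `SO(5)` and their derivatives -/

/-- The matrix entries of an element of `SO(5)`, in the normed space of arrays. -/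
def entries (g : G) : Fin 5 → Fin 5 → ℝ := fun i j => g.1 i j

/-- The velocity at `s = 0` of the curve `s ↦ g exp (s x)`. -/
def velocity (g : G) : so5 →ₗ[ℝ] (Fin 5 → Fin 5 → ℝ) where
  toFun x := fun i j => ∑ k, g.1 i k * x.1 k j
  map_add' x y := by
    ext i j
    simp [mul_add, Finset.sum_add_distrib]
  map_smul' c x := by
    ext i j
    simp [Finset.mul_sum, mul_left_comm]

theorem velocity_apply (g : G) (x : so5) (i j : Fin 5) :
    velocity g x i j = ∑ k, g.1 i k * x.1 k j := rfl

open scoped Matrix.Norms.Operator in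
theorem hasDerivAt_expG_apply (x : so5) (i j : Fin 5) :
    HasDerivAt (fun s : ℝ => (expG (s • x)).1 i j) (x.1 i j) 0 := by
  have h := hasDerivAt_exp_smul_const (𝕂 := ℝ) x.1 (0 : ℝ)
  rw [zero_smul, NormedSpace.exp_zero, one_mul] at h
  exact (LinearMap.toContinuousLinearMap
    (Matrix.entryLinearMap ℝ ℝ i j)).hasFDerivAt.comp_hasDerivAt (0 : ℝ) h

theorem expG_zero : expG 0 = 1 := Subtype.ext (by simp [expG])

theorem entries_mul_expG_zero (g : G) (x : so5) : g * expG ((0 : ℝ) • x) = g := by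
  rw [zero_smul, expG_zero, mul_one]

theorem hasDerivAt_entries_apply (g : G) (x : so5) (i j : Fin 5) :
    HasDerivAt (fun s : ℝ => entries (g * expG (s • x)) i j) (velocity g x i j) 0 := by
  have h : ∀ s : ℝ, entries (g * expG (s • x)) i j = ∑ k, g.1 i k * (expG (s • x)).1 k j :=
    fun s => Matrix.mul_apply
  simp only [h]
  exact HasDerivAt.fun_sum fun k _ => (hasDerivAt_expG_apply x k j).const_mul _

theorem hasDerivAt_entries (g : G) (x : so5) :
    HasDerivAt (fun s : ℝ => entries (g * expG (s • x))) (velocity g x) 0 :=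
  hasDerivAt_pi.2 fun i => hasDerivAt_pi.2 fun j => hasDerivAt_entries_apply g x i j

theorem hasDerivAt_of_extension {f : G → ℝ} {F : (Fin 5 → Fin 5 → ℝ) → ℝ} (hF : ContDiff ℝ ∞ F)
    (hf : ∀ g, f g = F (entries g)) (g : G) (x : so5) :
    HasDerivAt (fun s : ℝ => f (g * expG (s • x))) (fderiv ℝ F (entries g) (velocity g x)) 0 := by
  simp only [hf]
  -- The base point is left as the value of the curve at `0`, the form in which the chain rule needs
  -- it.
  have h1 : HasFDerivAt F (fderiv ℝ F (entries (g * expG ((0 : ℝ) • x))))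
      (entries (g * expG ((0 : ℝ) • x))) :=
    (hF.differentiable (by simp)).differentiableAt.hasFDerivAt
  have h := h1.comp_hasDerivAt (0 : ℝ) (hasDerivAt_entries g x)
  rwa [entries_mul_expG_zero] at h

/-- The derivative at `g` of a function on `SO(5)` in the left-invariant direction `x`. -/
def leftDeriv (f : G → ℝ) (g : G) (x : so5) : ℝ := deriv (fun s : ℝ => f (g * expG (s • x))) 0

theorem deriv₀_eq (X : G → so5) (f : G → ℝ) (g : G) : deriv₀ X f g = leftDeriv f g (X g) := rfl

theorem leftDeriv_of_extension {f : G → ℝ} {F : (Fin 5 → Fin 5 → ℝ) → ℝ} (hF : ContDiff ℝ ∞ F)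
    (hf : ∀ g, f g = F (entries g)) (g : G) (x : so5) :
    leftDeriv f g x = fderiv ℝ F (entries g) (velocity g x) :=
  (hasDerivAt_of_extension hF hf g x).deriv

namespace SmoothOnG

variable {f f' : G → ℝ}

theorem hasDerivAt (hf : SmoothOnG f) (g : G) (x : so5) :
    HasDerivAt (fun s : ℝ => f (g * expG (s • x))) (leftDeriv f g x) 0 := by
  obtain ⟨F, hF, h⟩ := hf
  exact (hasDerivAt_of_extension hF h g x).differentiableAt.hasDerivAt

theorem leftDeriv_add (hf : SmoothOnG f) (g : G) (x y : so5) :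
    leftDeriv f g (x + y) = leftDeriv f g x + leftDeriv f g y := by
  obtain ⟨F, hF, h⟩ := hf
  simp only [leftDeriv_of_extension hF h, map_add]

theorem leftDeriv_smul (hf : SmoothOnG f) (g : G) (c : ℝ) (x : so5) :
    leftDeriv f g (c • x) = c * leftDeriv f g x := by
  obtain ⟨F, hF, h⟩ := hf
  simp only [leftDeriv_of_extension hF h, map_smul, smul_eq_mul]

theorem const (c : ℝ) : SmoothOnG fun _ => c := ⟨fun _ => c, contDiff_const, fun _ => rfl⟩

theorem entry (i j : Fin 5) : SmoothOnG fun g => g.1 i j :=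
  ⟨fun p => p i j, by fun_prop, fun _ => rfl⟩

theorem add (hf : SmoothOnG f) (hf' : SmoothOnG f') : SmoothOnG fun g => f g + f' g := by
  obtain ⟨F, hF, h⟩ := hf
  obtain ⟨F', hF', h'⟩ := hf'
  exact ⟨fun p => F p + F' p, hF.add hF', fun g => congrArg₂ (· + ·) (h g) (h' g)⟩

theorem sub (hf : SmoothOnG f) (hf' : SmoothOnG f') : SmoothOnG fun g => f g - f' g := by
  obtain ⟨F, hF, h⟩ := hf
  obtain ⟨F', hF', h'⟩ := hf'
  exact ⟨fun p => F p - F' p, hF.sub hF', fun g => congrArg₂ (· - ·) (h g) (h' g)⟩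

theorem mul (hf : SmoothOnG f) (hf' : SmoothOnG f') : SmoothOnG fun g => f g * f' g := by
  obtain ⟨F, hF, h⟩ := hf
  obtain ⟨F', hF', h'⟩ := hf'
  exact ⟨fun p => F p * F' p, hF.mul hF', fun g => congrArg₂ (· * ·) (h g) (h' g)⟩

theorem sum {ι : Type*} (s : Finset ι) {f : ι → G → ℝ} (hf : ∀ i, SmoothOnG (f i)) :
    SmoothOnG fun g => ∑ i ∈ s, f i g := by
  choose F hF h using hf
  exact ⟨fun p => ∑ i ∈ s, F i p, ContDiff.sum fun i _ => hF i,
    fun g => Finset.sum_congr rfl fun i _ => h i g⟩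

theorem leftDeriv_smooth (hf : SmoothOnG f) {X : G → so5}
    (hX : ∀ i j, SmoothOnG fun g => (X g).1 i j) : SmoothOnG fun g => leftDeriv f g (X g) := by
  obtain ⟨F, hF, h⟩ := hf
  choose Φ hΦ hX using hX
  -- The velocity `g X(g)` extends to all arrays `p` as the product of `p` with an extension `Φ` of
  -- `X`.
  refine ⟨fun p => fderiv ℝ F p fun i j => ∑ k, p i k * Φ k j p, ?_, fun g => ?_⟩
  · refine (hF.fderiv_right (m := ∞) (by simp)).clm_apply ?_
    refine contDiff_pi.2 fun i => contDiff_pi.2 fun j => ContDiff.sum fun k _ => ?_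
    exact ContDiff.mul (by fun_prop) (hΦ k j)
  · change leftDeriv f g (X g)
      = fderiv ℝ F (entries g) (fun i j => ∑ k, g.1 i k * Φ k j (entries g))
    rw [leftDeriv_of_extension hF h]
    congr 1
    ext i j
    rw [velocity_apply]
    exact Finset.sum_congr rfl fun k _ => congrArg _ (hX k j g)

/-- The commutator of two derivatives along vector-valued functions. -/
theorem commutator (hf : SmoothOnG f) {X Y : G → so5} (hX : ∀ i j, SmoothOnG fun g => (X g).1 i j)
    (hY : ∀ i j, SmoothOnG fun g => (Y g).1 i j) (g : G) :
    deriv₀ X (deriv₀ Y f) g - deriv₀ Y (deriv₀ X f) g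
      = leftDeriv f g (⁅X g, Y g⁆ + nablaCan X Y g - nablaCan Y X g) := by
  obtain ⟨F, hF, h⟩ := hf
  -- A Hessian term plus the derivative of the velocity `g Y(g)`. The Hessian terms cancel by
  -- symmetry, and the products `g X Y` and `g Y X` leave the matrix commutator.
  have key : ∀ X Y : G → so5, (∀ i j, SmoothOnG fun g => (Y g).1 i j) →
      deriv₀ X (deriv₀ Y f) g
        = fderiv ℝ (fderiv ℝ F) (entries g) (velocity g (X g)) (velocity g (Y g))
          + fderiv ℝ F (entries g) (fun i j =>
            ∑ k, (velocity g (X g) i k * (Y g).1 k j + g.1 i k * (nablaCan X Y g).1 k j)) := by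
    intro X Y hY
    have h1 : HasDerivAt (fun s : ℝ => fderiv ℝ F (entries (g * expG (s • X g))))
        (fderiv ℝ (fderiv ℝ F) (entries g) (velocity g (X g))) 0 := by
      have hd : HasFDerivAt (fderiv ℝ F) (fderiv ℝ (fderiv ℝ F)
          (entries (g * expG ((0 : ℝ) • X g)))) (entries (g * expG ((0 : ℝ) • X g))) :=
        ((hF.fderiv_right (m := ∞) (by simp)).differentiable
          (by simp)).differentiableAt.hasFDerivAt
      have := hd.comp_hasDerivAt (0 : ℝ) (hasDerivAt_entries g (X g))
      rwa [entries_mul_expG_zero] at this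
    have h2 : HasDerivAt (fun s : ℝ => velocity (g * expG (s • X g)) (Y (g * expG (s • X g))))
        (fun i j =>
          ∑ k, (velocity g (X g) i k * (Y g).1 k j + g.1 i k * (nablaCan X Y g).1 k j)) 0 := by
      refine hasDerivAt_pi.2 fun i => hasDerivAt_pi.2 fun j => ?_
      change HasDerivAt (fun s : ℝ => ∑ k, entries (g * expG (s • X g)) i k *
        (Y (g * expG (s • X g))).1 k j) _ 0
      refine HasDerivAt.fun_sum fun k _ => ?_
      have ha := hasDerivAt_entries_apply g (X g) i k
      have hb := (hY k j).hasDerivAt g (X g)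
      have hab := ha.mul hb
      rw [entries_mul_expG_zero] at hab
      exact hab
    have h3 := h1.clm_apply h2
    rw [entries_mul_expG_zero] at h3
    have h4 : ∀ a, deriv₀ Y f a = fderiv ℝ F (entries a) (velocity a (Y a)) :=
      fun a => leftDeriv_of_extension hF h a (Y a)
    rw [deriv₀]
    simp only [h4]
    exact h3.deriv
  have hsymm : IsSymmSndFDerivAt ℝ F (entries g) :=
    hF.contDiffAt.isSymmSndFDerivAt (by simp; exact WithTop.coe_le_coe.2 le_top)
  rw [key X Y hY, key Y X hX, hsymm (velocity g (X g)), add_sub_add_left_eq_sub, ← map_sub,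
    leftDeriv_of_extension hF h]
  congr 1
  ext i j
  simp only [Pi.sub_apply, velocity_apply, sub_val, add_val, lie_val, Matrix.sub_apply,
    Matrix.mul_apply]
  simp only [Fin.sum_univ_five]
  ring

theorem leftDeriv_eq_zero {f : G → ℝ} {g : G} {x : so5} (h : ∀ s : ℝ, expG (s • x) ∈ H)
    (hf : ∀ h ∈ H, f (g * h) = f g) : leftDeriv f g x = 0 := by
  rw [leftDeriv]
  simp only [hf _ (h _), deriv_const]

end SmoothOnG

/-! ### The exponential map -/

theorem expG_Ad (h : G) (x : so5) : expG (Ad h x) = h * expG x * h⁻¹ := by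
  have hu : IsUnit h.1 := ⟨⟨h.1, h.1.transpose, mul_transpose_self h, transpose_mul_self h⟩, rfl⟩
  have hi : h.1⁻¹ = h.1.transpose := Matrix.inv_eq_right_inv (mul_transpose_self h)
  refine Subtype.ext ?_
  have e := Matrix.exp_conj h.1 x.1 hu
  rw [hi, ← Ad_val, ← inv_val] at e
  exact e

theorem expG_add_self (x : so5) : expG ((1 / 2 : ℝ) • x) * expG ((1 / 2 : ℝ) • x) = expG x := by
  refine Subtype.ext ?_
  change NormedSpace.exp ((1 / 2 : ℝ) • x.1) * NormedSpace.exp ((1 / 2 : ℝ) • x.1)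
    = NormedSpace.exp x.1
  rw [← Matrix.exp_add_of_commute _ _ (Commute.refl _), ← add_smul]
  norm_num

/-- A block diagonal `x` commutes with the coordinate projection onto the block of `i`, hence so
does its exponential. -/
theorem expG_apply_eq_zero {x : so5} (hx : x ∈ comp 0) {i j : Fin 5} (hij : w i ≠ w j) :
    (expG x).1 i j = 0 := by
  have hc : Commute (Matrix.diagonal fun k => if w i = w k then (1 : ℝ) else 0) x.1 := by
    ext k l
    rw [Matrix.diagonal_mul, Matrix.mul_diagonal]
    by_cases hkl : w k = w l
    · rw [hkl, mul_comm]
    · rw [hx k l (mt (w_add_eq_zero k l).1 hkl), mul_zero, zero_mul]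
  have he := congrFun (congrFun (Commute.exp_right hc).eq i) j
  rw [Matrix.diagonal_mul, Matrix.mul_diagonal, if_pos rfl, if_neg hij, one_mul, mul_zero] at he
  exact he

/-- Each diagonal block of the exponential is orthogonal, so its determinant squares to one; it is
also the square of the determinant of the same block of `exp (x / 2)`, hence equal to one. -/
theorem expG_mem {x : so5} (hx : x ∈ comp 0) : expG x ∈ H := by
  set M := expG x with hM
  set N := expG ((1 / 2 : ℝ) • x) with hN
  have zM : ∀ i j, w i ≠ w j → M.1 i j = 0 := fun i j h => expG_apply_eq_zero hx h
  have zN : ∀ i j, w i ≠ w j → N.1 i j = 0 :=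
    fun i j h => expG_apply_eq_zero (Submodule.smul_mem _ _ hx) h
  have sq : ∀ i j, M.1 i j = ∑ k, N.1 i k * N.1 k j := by
    intro i j
    rw [hM, ← expG_add_self x]
    exact Matrix.mul_apply
  have orth : ∀ i j, ∑ k, M.1 i k * M.1 j k = if i = j then 1 else 0 := by
    intro i j
    have h := congrFun (congrFun (mul_transpose_self M) i) j
    rwa [Matrix.mul_apply, Matrix.one_apply] at h
  have one : ∀ a b : ℝ, a ^ 2 = 1 → a = b ^ 2 → a = 1 := by
    intro a b h1 h2
    nlinarith [sq_nonneg b]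
  have m02 := zM 0 2 (by decide)
  have m03 := zM 0 3 (by decide)
  have m04 := zM 0 4 (by decide)
  have m12 := zM 1 2 (by decide)
  have m13 := zM 1 3 (by decide)
  have m14 := zM 1 4 (by decide)
  have m20 := zM 2 0 (by decide)
  have m21 := zM 2 1 (by decide)
  have m24 := zM 2 4 (by decide)
  have m30 := zM 3 0 (by decide)
  have m31 := zM 3 1 (by decide)
  have m34 := zM 3 4 (by decide)
  have m40 := zM 4 0 (by decide)
  have m41 := zM 4 1 (by decide)
  have m42 := zM 4 2 (by decide)
  have m43 := zM 4 3 (by decide)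
  have o00 := orth 0 0
  have o01 := orth 0 1
  have o11 := orth 1 1
  have o22 := orth 2 2
  have o23 := orth 2 3
  have o33 := orth 3 3
  have o44 := orth 4 4
  simp [Fin.sum_univ_five, m02, m03, m04, m12, m13, m14, m20, m21, m24, m30, m31, m34, m40, m41,
    m42, m43] at o00 o01 o11 o22 o23 o33 o44
  refine ⟨zM, one _ (N.1 0 0 * N.1 1 1 - N.1 0 1 * N.1 1 0) ?_ ?_,
    one _ (N.1 2 2 * N.1 3 3 - N.1 2 3 * N.1 3 2) ?_ ?_, one _ (N.1 4 4) ?_ ?_⟩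
  -- The squared determinant is the Gram determinant of the two rows.
  · linear_combination (M.1 1 0 * M.1 1 0 + M.1 1 1 * M.1 1 1) * o00 + o11
      - (M.1 0 0 * M.1 1 0 + M.1 0 1 * M.1 1 1) * o01
  · simp only [sq, Fin.sum_univ_five]
    rw [zN 0 2 (by decide), zN 0 3 (by decide), zN 0 4 (by decide), zN 1 2 (by decide),
      zN 1 3 (by decide), zN 1 4 (by decide)]
    ring
  · linear_combination (M.1 3 2 * M.1 3 2 + M.1 3 3 * M.1 3 3) * o22 + o33
      - (M.1 2 2 * M.1 3 2 + M.1 2 3 * M.1 3 3) * o23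
  · simp only [sq, Fin.sum_univ_five]
    rw [zN 2 0 (by decide), zN 2 1 (by decide), zN 2 4 (by decide), zN 3 0 (by decide),
      zN 3 1 (by decide), zN 3 4 (by decide)]
    ring
  · linear_combination o44
  · simp only [sq, Fin.sum_univ_five]
    rw [zN 4 0 (by decide), zN 4 1 (by decide), zN 4 2 (by decide), zN 4 3 (by decide)]
    ring

/-! ### The canonical torsion-free connection -/

theorem nablaCan_val (X Y : G → so5) (g : G) (i j : Fin 5) :
    (nablaCan X Y g).1 i j = leftDeriv (fun a => (Y a).1 i j) g (X g) := rfl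

theorem nablaBar_val (X Y : G → so5) (g : G) (i j : Fin 5) :
    (nablaBar X Y g).1 i j = leftDeriv (fun a => (Y a).1 i j) g (X g)
      + 1 / 2 * (mPart ⁅X g, Y g⁆).1 i j := by
  rw [nablaBar, sub_val, smul_val, torsionCan, neg_val, nablaCan_val]
  ring

theorem mPart_add (X Y : so5) : mPart (X + Y) = mPart X + mPart Y :=
  ext_so5 fun i j => by
    simp only [mPart_val, add_val]
    split_ifs <;> simp

theorem mPart_smul (c : ℝ) (X : so5) : mPart (c • X) = c • mPart X :=
  ext_so5 fun i j => by
    simp only [mPart_val, smul_val]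
    split_ifs <;> simp

theorem mPart_neg (X : so5) : mPart (-X) = -mPart X :=
  ext_so5 fun i j => by
    simp only [mPart_val, neg_val]
    split_ifs <;> simp

theorem smooth_mPart {X : G → so5} (hX : ∀ i j, SmoothOnG fun g => (X g).1 i j) (i j : Fin 5) :
    SmoothOnG fun g => (mPart (X g)).1 i j := by
  simp only [mPart_val]
  split_ifs
  · exact SmoothOnG.const 0
  · exact hX i j

theorem smooth_lie {X Y : G → so5} (hX : ∀ i j, SmoothOnG fun g => (X g).1 i j)
    (hY : ∀ i j, SmoothOnG fun g => (Y g).1 i j) (i j : Fin 5) :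
    SmoothOnG fun g => (⁅X g, Y g⁆ : so5).1 i j := by
  simp only [lie_val, Matrix.sub_apply, Matrix.mul_apply]
  exact (SmoothOnG.sum _ fun k => (hX i k).mul (hY k j)).sub
    (SmoothOnG.sum _ fun k => (hY i k).mul (hX k j))

theorem leftDeriv_const (c : ℝ) (g : G) (x : so5) : leftDeriv (fun _ => c) g x = 0 := by
  simp [leftDeriv]

/-- Since `g h exp (s Ad h⁻¹ x) = g exp (s x) h`. This makes the canonical derivative of equivariant
maps equivariant. -/
theorem leftDeriv_mul_right (f : G → ℝ) (g h : G) (x : so5) :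
    leftDeriv f (g * h) (Ad h⁻¹ x) = leftDeriv (fun a => f (a * h)) g x := by
  simp only [leftDeriv, ← Ad_smul, expG_Ad]
  congr 1
  ext s
  congr 1
  group

theorem leftDeriv_add_fun {f f' : G → ℝ} (hf : SmoothOnG f) (hf' : SmoothOnG f') (g : G)
    (x : so5) : leftDeriv (fun a => f a + f' a) g x = leftDeriv f g x + leftDeriv f' g x :=
  ((hf.hasDerivAt g x).add (hf'.hasDerivAt g x)).deriv

theorem leftDeriv_mul_fun {f f' : G → ℝ} (hf : SmoothOnG f) (hf' : SmoothOnG f') (g : G)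
    (x : so5) :
    leftDeriv (fun a => f a * f' a) g x = leftDeriv f g x * f' g + f g * leftDeriv f' g x := by
  have h := ((hf.hasDerivAt g x).mul (hf'.hasDerivAt g x)).deriv
  rwa [entries_mul_expG_zero] at h

theorem leftDeriv_sum_fun {ι : Type*} (s : Finset ι) {f : ι → G → ℝ} (hf : ∀ i, SmoothOnG (f i))
    (g : G) (x : so5) :
    leftDeriv (fun a => ∑ i ∈ s, f i a) g x = ∑ i ∈ s, leftDeriv (f i) g x :=
  (HasDerivAt.fun_sum fun i _ => (hf i).hasDerivAt g x).deriv

theorem leftDeriv_Ad {Y : G → so5} (hY : ∀ i j, SmoothOnG fun g => (Y g).1 i j) (h : G)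
    (g : G) (x : so5) (i j : Fin 5) :
    leftDeriv (fun a => (Ad h (Y a)).1 i j) g x
      = ∑ l, ∑ k, h.1 i k * leftDeriv (fun a => (Y a).1 k l) g x * h.1 j l := by
  simp only [Ad_apply]
  have hs : ∀ k l, SmoothOnG fun a => h.1 i k * (Y a).1 k l * h.1 j l := fun k l =>
    ((SmoothOnG.const _).mul (hY k l)).mul (SmoothOnG.const _)
  rw [leftDeriv_sum_fun _ fun l => SmoothOnG.sum _ fun k => hs k l]
  refine Finset.sum_congr rfl fun l _ => ?_
  rw [leftDeriv_sum_fun _ fun k => hs k l]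
  refine Finset.sum_congr rfl fun k _ => ?_
  rw [leftDeriv_mul_fun ((SmoothOnG.const _).mul (hY k l)) (SmoothOnG.const _),
    leftDeriv_mul_fun (SmoothOnG.const _) (hY k l), leftDeriv_const, leftDeriv_const]
  ring

theorem nablaCan_isVectorField {X Y : G → so5} (hX : IsVectorField X) (hY : IsVectorField Y) :
    IsVectorField (nablaCan X Y) where
  mem g := mem_m.2 fun i j hij => by
    have h : (fun a => (Y a).1 i j) = fun _ => 0 := funext fun a => mem_m.1 (hY.mem a) i j hij
    rw [nablaCan_val, h, leftDeriv_const]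
  smooth i j := (hY.smooth i j).leftDeriv_smooth hX.smooth
  equivariant g h hh := by
    refine ext_so5 fun i j => ?_
    rw [nablaCan_val, hX.equivariant g h hh, leftDeriv_mul_right]
    simp only [hY.equivariant _ h hh]
    rw [leftDeriv_Ad hY.smooth, Ad_apply]
    rfl

theorem nablaBar_isVectorField {X Y : G → so5} (hX : IsVectorField X) (hY : IsVectorField Y) :
    IsVectorField (nablaBar X Y) := by
  have hc := nablaCan_isVectorField hX hY
  have e : ∀ g, nablaBar X Y g = nablaCan X Y g + (1 / 2 : ℝ) • mPart ⁅X g, Y g⁆ := fun g => by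
    rw [nablaBar, torsionCan, smul_neg, sub_neg_eq_add]
  refine ⟨fun g => ?_, fun i j => ?_, fun g h hh => ?_⟩
  · rw [e]
    exact add_mem (hc.mem g) (Submodule.smul_mem _ _ (mPart_mem _))
  · simp only [e, add_val, smul_val]
    exact (hc.smooth i j).add
      ((SmoothOnG.const _).mul (smooth_mPart (smooth_lie hX.smooth hY.smooth) i j))
  · rw [e, e, hc.equivariant g h hh, hX.equivariant g h hh, hY.equivariant g h hh, ← Ad_lie,
      ← Ad_mPart (inv_mem hh), Ad_add, Ad_smul]

theorem nablaBar_isAffineConnection : IsAffineConnection nablaBar where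
  isVectorField _ _ hX hY := nablaBar_isVectorField hX hY
  add_left X X' Y hX hX' hY g := by
    refine ext_so5 fun i j => ?_
    simp only [add_val, nablaBar_val, (hY.smooth i j).leftDeriv_add, add_lie, mPart_add]
    ring
  add_right X Y Y' hX hY hY' g := by
    refine ext_so5 fun i j => ?_
    simp only [add_val, nablaBar_val, leftDeriv_add_fun (hY.smooth i j) (hY'.smooth i j), lie_add,
      mPart_add]
    ring
  smul_left f X Y hf hX hY g := by
    refine ext_so5 fun i j => ?_
    simp only [smul_val, nablaBar_val, (hY.smooth i j).leftDeriv_smul, smul_lie, mPart_smul]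
    ring
  leibniz f X Y hf hX hY g := by
    refine ext_so5 fun i j => ?_
    simp only [add_val, smul_val, nablaBar_val, lie_smul, mPart_smul]
    rw [leftDeriv_mul_fun hf (hY.smooth i j), derivM, deriv₀_eq]
    ring

/-- The commutator of the lifted fields is `[X, Y] + ∇_X Y - ∇_Y X`. The `m`-part of the bracket is
the sum of the two torsion corrections, and the `g_e`-part is tangent to the fibres of `G → M`, so
it kills functions lifted from `M`. -/
theorem nablaBar_isTorsionFree : IsTorsionFree nablaBar := by
  intro X Y hX hY f hf g
  have hcomm := SmoothOnG.commutator hf hX.smooth hY.smooth g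
  have hvert : leftDeriv (fun a => f (QuotientGroup.mk a)) g (part 0 ⁅X g, Y g⁆).1 = 0 :=
    SmoothOnG.leftDeriv_eq_zero
      (fun s => expG_mem (Submodule.smul_mem _ s (part 0 ⁅X g, Y g⁆).2))
      (fun h hh => congrArg f (QuotientGroup.mk_mul_of_mem g hh))
  have e : ⁅X g, Y g⁆ + nablaCan X Y g - nablaCan Y X g
      = (nablaBar X Y g - nablaBar Y X g) + (part 0 ⁅X g, Y g⁆).1 := by
    have hs : (⁅Y g, X g⁆ : so5) = -⁅X g, Y g⁆ := (lie_skew _ _).symm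
    rw [nablaBar, nablaBar, torsionCan, torsionCan, hs, mPart_neg, mPart]
    module
  rw [e, hf.leftDeriv_add, hvert, add_zero] at hcomm
  exact hcomm.symm

/-! ### The metric -/

theorem bilin_apply (B : LinearMap.BilinForm ℝ so5) (X Y : so5) :
    B X Y = ∑ i, ∑ j, ∑ k, ∑ l,
      X.1 k l * Y.1 i j * (B (skewUnit k l) (skewUnit i j) / 4) := by
  conv_lhs => rw [sum_skewUnit X, sum_skewUnit Y]
  simp only [map_sum, LinearMap.sum_apply, map_smul, LinearMap.smul_apply, smul_eq_mul,
    Finset.mul_sum]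
  refine Finset.sum_congr rfl fun i _ => Finset.sum_congr rfl fun j _ =>
    Finset.sum_congr rfl fun k _ => Finset.sum_congr rfl fun l _ => ?_
  ring

/-- The metric is parallel for the canonical connection. -/
theorem deriv₀_metric (B : LinearMap.BilinForm ℝ so5) {X Y Z : G → so5}
    (hY : ∀ i j, SmoothOnG fun g => (Y g).1 i j) (hZ : ∀ i j, SmoothOnG fun g => (Z g).1 i j)
    (g : G) : deriv₀ X (metric B Y Z) g
      = B (nablaCan X Y g) (Z g) + B (Y g) (nablaCan X Z g) := by
  have hm : metric B Y Z = fun a => ∑ i, ∑ j, ∑ k, ∑ l,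
      (Y a).1 k l * (Z a).1 i j * (B (skewUnit k l) (skewUnit i j) / 4) :=
    funext fun a => bilin_apply B _ _
  have hs : ∀ i j k l, SmoothOnG fun a =>
      (Y a).1 k l * (Z a).1 i j * (B (skewUnit k l) (skewUnit i j) / 4) :=
    fun i j k l => ((hY k l).mul (hZ i j)).mul (SmoothOnG.const _)
  rw [deriv₀_eq, hm, bilin_apply B (nablaCan X Y g), bilin_apply B (Y g),
    ← Finset.sum_add_distrib, leftDeriv_sum_fun _ fun i => SmoothOnG.sum _ fun j =>
      SmoothOnG.sum _ fun k => SmoothOnG.sum _ fun l => hs i j k l]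
  refine Finset.sum_congr rfl fun i _ => ?_
  rw [← Finset.sum_add_distrib, leftDeriv_sum_fun _ fun j =>
      SmoothOnG.sum _ fun k => SmoothOnG.sum _ fun l => hs i j k l]
  refine Finset.sum_congr rfl fun j _ => ?_
  rw [← Finset.sum_add_distrib, leftDeriv_sum_fun _ fun k => SmoothOnG.sum _ fun l => hs i j k l]
  refine Finset.sum_congr rfl fun k _ => ?_
  rw [← Finset.sum_add_distrib, leftDeriv_sum_fun _ fun l => hs i j k l]
  refine Finset.sum_congr rfl fun l _ => ?_
  rw [leftDeriv_mul_fun ((hY k l).mul (hZ i j)) (SmoothOnG.const _),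
    leftDeriv_mul_fun (hY k l) (hZ i j), leftDeriv_const, nablaCan_val, nablaCan_val]
  ring

theorem metric_nablaBar (B : LinearMap.BilinForm ℝ so5) (X Y Z : G → so5) (g : G) :
    metric B (nablaBar X Y) Z g + metric B Y (nablaBar X Z) g
      = B (nablaCan X Y g) (Z g) + B (Y g) (nablaCan X Z g)
        + 1 / 2 * (B (mPart ⁅X g, Y g⁆) (Z g) + B (Y g) (mPart ⁅X g, Z g⁆)) := by
  simp only [metric, nablaBar, torsionCan, map_sub, map_smul, map_neg, LinearMap.sub_apply,
    LinearMap.smul_apply, LinearMap.neg_apply, smul_eq_mul]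
  ring

/-- The vector field on `M` generated by the action of a one-parameter group of `SO(5)`. -/
def fundamentalField (x : so5) (g : G) : so5 := mPart (Ad g⁻¹ x)

theorem fundamentalField_isVectorField (x : so5) : IsVectorField (fundamentalField x) where
  mem g := mPart_mem _
  smooth i j := by
    refine smooth_mPart (X := fun g => Ad g⁻¹ x) (fun i j => ?_) i j
    simp only [Ad_apply, inv_val, Matrix.transpose_apply]
    exact SmoothOnG.sum _ fun l => SmoothOnG.sum _ fun k =>
      ((SmoothOnG.entry k i).mul (SmoothOnG.const _)).mul (SmoothOnG.entry l j)
  equivariant g h hh := by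
    rw [fundamentalField, fundamentalField, mul_inv_rev, Ad_mul, Ad_mPart (inv_mem hh)]

theorem fundamentalField_one {x : so5} (hx : x ∈ m) : fundamentalField x 1 = x := by
  have h : Ad 1⁻¹ x = x := Subtype.ext (by simp [Ad_val])
  rw [fundamentalField, h, mPart_eq_self hx]

/-- `B` is naturally reductive with respect to `so(5) = g_e ⊕ m`. -/
def IsNaturallyReductive (B : LinearMap.BilinForm ℝ so5) : Prop :=
  ∀ x ∈ m, ∀ y ∈ m, ∀ z ∈ m, B (mPart ⁅x, y⁆) z + B y (mPart ⁅x, z⁆) = 0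

/-- As `B` is parallel for the canonical connection, only the bracket terms remain in the metric
condition. Fundamental fields take every value in `m` at the identity, so the condition on fields
gives the one on vectors. -/
theorem isLeviCivita_nablaBar_iff (B : LinearMap.BilinForm ℝ so5) :
    IsLeviCivita B nablaBar ↔ IsNaturallyReductive B := by
  constructor
  · intro h x hx y hy z hz
    have hX := fundamentalField_isVectorField x
    have hY := fundamentalField_isVectorField y
    have hZ := fundamentalField_isVectorField z
    have hp := h.parallel _ _ _ hX hY hZ 1
    rw [metric_nablaBar, deriv₀_metric B hY.smooth hZ.smooth, fundamentalField_one hx,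
      fundamentalField_one hy, fundamentalField_one hz] at hp
    linarith
  · intro h
    refine ⟨nablaBar_isAffineConnection, nablaBar_isTorsionFree, fun X Y Z hX hY hZ g => ?_⟩
    rw [metric_nablaBar, deriv₀_metric B hY.smooth hZ.smooth,
      h _ (hX.mem g) _ (hY.mem g) _ (hZ.mem g)]
    ring

/-! ### Adapted metrics -/

section

variable {B : LinearMap.BilinForm ℝ so5} {q₁ : LinearMap.BilinForm ℝ (comp 0)} {t u v w : ℝ}

theorem HasForm.apply_of_mem_m (h : HasForm B q₁ t u v w) (hq : IsInner q₁) {X Y : so5}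
    (hX : X ∈ m) : B X Y = t * (α₁ X * α₁ Y + α₂ X * α₂ Y + α₃ X * α₃ Y + α₄ X * α₄ Y)
      + u / 2 * (α₁ X * α₄ Y + α₁ Y * α₄ X - α₂ X * α₃ Y - α₂ Y * α₃ X)
      + v * (β₁ X * β₁ Y + β₂ X * β₂ Y) + w * (γ₁ X * γ₁ Y + γ₂ X * γ₂ Y) := by
  rw [h.apply hq, part_zero_of_mem_m hX, map_zero, LinearMap.zero_apply, zero_add]

theorem HasForm.eq_trace (h : HasForm B q₁ t 0 t t) (hq : IsInner q₁) {X Y : so5} (hX : X ∈ m) :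
    B X Y = -(t / 2) * (X.1 * Y.1).trace := by
  rw [h.apply_of_mem_m hq hX, Matrix.trace]
  simp only [Matrix.diag_apply, Matrix.mul_apply, Fin.sum_univ_five, α₁, α₂, α₃, α₄, β₁, β₂, γ₁,
    γ₂, skew_apply Y 0 1, skew_apply Y 0 2, skew_apply Y 0 3, skew_apply Y 0 4,
    skew_apply Y 1 2, skew_apply Y 1 3, skew_apply Y 1 4, skew_apply Y 2 3, skew_apply Y 2 4,
    skew_apply Y 3 4, skew_apply X 0 2, skew_apply X 0 3, skew_apply X 0 4,
    skew_apply X 1 2, skew_apply X 1 3, skew_apply X 1 4, skew_apply X 2 4,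
    skew_apply X 3 4, diag_eq_zero, mem_m.1 hX 0 1 rfl, mem_m.1 hX 2 3 rfl, mem_m.1 hX 1 0 rfl,
    mem_m.1 hX 3 2 rfl]
  ring

/-- As `m` is orthogonal to `g_e`, projections inside `B` can be dropped, so natural reductivity
becomes a statement about full brackets. -/
theorem HasForm.apply_mPart (h : HasForm B q₁ t u v w) (hq : IsInner q₁) {X : so5} (hX : X ∈ m)
    (Y : so5) : B X (mPart Y) = B X Y := by
  rw [h.apply_of_mem_m hq hX, h.apply_of_mem_m hq hX]
  simp [α₁, α₂, α₃, α₄, β₁, β₂, γ₁, γ₂, mPart_val, SO5.w]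

theorem HasForm.invariant_of_trace (h : HasForm B q₁ t 0 t t) (hq : IsInner q₁) {g : G}
    (hg : g ∈ H) {X Y : so5} (hX : X ∈ m) : B (Ad g X) (Ad g Y) = B X Y := by
  rw [h.eq_trace hq hX, h.eq_trace hq (Ad_mem hg hX), Ad_val, Ad_val]
  congr 1
  calc _ = (g.1 * X.1 * (g.1.transpose * g.1) * Y.1 * g.1.transpose).trace := by
        simp only [Matrix.mul_assoc]
    _ = (g.1 * (X.1 * Y.1) * g.1.transpose).trace := by
        rw [transpose_mul_self, Matrix.mul_one]; simp only [Matrix.mul_assoc]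
    _ = _ := by rw [Matrix.trace_mul_comm, ← Matrix.mul_assoc, transpose_mul_self, Matrix.one_mul]

theorem HasForm.isNaturallyReductive (h : HasForm B q₁ t 0 t t) (hq : IsInner q₁) :
    IsNaturallyReductive B := by
  intro x hx y hy z hz
  rw [h.1 (mPart _) z, h.apply_mPart hq hz, h.apply_mPart hq hy, h.eq_trace hq hz,
    h.eq_trace hq hy, lie_val, lie_val, mul_sub, mul_sub, Matrix.trace_sub, Matrix.trace_sub]
  simp only [← Matrix.mul_assoc]
  linear_combination -(t / 2) * Matrix.trace_mul_cycle z.1 x.1 y.1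
    - (t / 2) * Matrix.trace_mul_cycle y.1 x.1 z.1

theorem tau_val (γ : ZMod 2 × ZMod 2) (X : so5) (i j : Fin 5) :
    (tau γ X).1 i j = sgn γ (SO5.w i) * sgn γ (SO5.w j) * X.1 i j := by
  simp only [tau, S, Matrix.mul_diagonal, Matrix.diagonal_mul]
  ring

theorem HasForm.symmetriesAreIsometries (h : HasForm B q₁ t 0 t t) (hq : IsInner q₁) :
    SymmetriesAreIsometries B := by
  intro γ X hX Y _
  have hX' : tau γ X ∈ m := mem_m.2 fun i j hij => by rw [tau_val, mem_m.1 hX i j hij, mul_zero]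
  have sq : ∀ i, sgn γ (SO5.w i) * sgn γ (SO5.w i) = 1 := by
    intro i
    rw [sgn]
    split_ifs <;> norm_num
  -- The symmetry only changes signs of entries, and for `u = 0` the form pairs each entry with
  -- itself.
  have key : ∀ i j, (tau γ X).1 i j * (tau γ Y).1 i j = X.1 i j * Y.1 i j := by
    intro i j
    rw [tau_val, tau_val]
    linear_combination (sgn γ (SO5.w i) * sgn γ (SO5.w i) * X.1 i j * Y.1 i j) * sq j
      + (X.1 i j * Y.1 i j) * sq i
  rw [h.apply_of_mem_m hq hX, h.apply_of_mem_m hq hX']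
  simp only [α₁, α₂, α₃, α₄, β₁, β₂, γ₁, γ₂, key]
  ring

theorem skewUnit_mem_m {i j : Fin 5} (hij : SO5.w i ≠ SO5.w j) : skewUnit i j ∈ m := by
  refine mem_m.2 fun k l hkl => ?_
  rw [skewUnit_val, if_neg, if_neg, sub_zero]
  · rintro ⟨rfl, rfl⟩; exact hij hkl.symm
  · rintro ⟨rfl, rfl⟩; exact hij hkl

theorem IsNaturallyReductive.coefficients (hB : IsNaturallyReductive B)
    (h : HasForm B q₁ t u v w) (hq : IsInner q₁) : u = 0 ∧ t = v ∧ v = w := by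
  have key : ∀ i j k l p q, SO5.w i ≠ SO5.w j → SO5.w k ≠ SO5.w l → SO5.w p ≠ SO5.w q →
      B (skewUnit p q) ⁅skewUnit i j, skewUnit k l⁆
        + B (skewUnit k l) ⁅skewUnit i j, skewUnit p q⁆ = 0 := by
    intro i j k l p q hij hkl hpq
    have := hB _ (skewUnit_mem_m hij) _ (skewUnit_mem_m hkl) _ (skewUnit_mem_m hpq)
    rwa [h.1 (mPart _), h.apply_mPart hq (skewUnit_mem_m hpq),
      h.apply_mPart hq (skewUnit_mem_m hkl)] at this
  -- In the first triple one bracket vanishes and the other is `-skewUnit 0 2`, which isolates `u`.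
  -- The other two triples stay in the copy of `so(3)` on the indices `0, 2, 4` and give `w = t` and
  -- `t = v`.
  have k1 := key 0 4 1 3 2 4 (by decide) (by decide) (by decide)
  have k2 := key 0 4 0 2 2 4 (by decide) (by decide) (by decide)
  have k3 := key 2 4 0 2 0 4 (by decide) (by decide) (by decide)
  rw [h.apply_of_mem_m hq (skewUnit_mem_m (by decide)),
    h.apply_of_mem_m hq (skewUnit_mem_m (by decide)), lie_skewUnit, lie_skewUnit] at k1 k2 k3
  simp [α₁, α₂, α₃, α₄, β₁, β₂, γ₁, γ₂, skewUnit_val] at k1 k2 k3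
  refine ⟨?_, ?_, ?_⟩ <;> linarith

theorem HasForm.isAdapted_iff (h : HasForm B q₁ t u v w) (hq : IsInner q₁)
    (htu : 0 < 4 * t ^ 2 - u ^ 2) (ht : 0 < t) (hv : 0 < v) (hw : 0 < w) :
    IsAdapted B ↔ u = 0 ∧ t = v ∧ v = w := by
  constructor
  · intro hB
    exact ((isLeviCivita_nablaBar_iff B).1 hB.leviCivita).coefficients h hq
  · rintro ⟨rfl, rfl, rfl⟩
    have hB := h.isInner hq htu ht ht ht
    refine ⟨⟨⟨fun x y => hB.symm x y, fun x hx => hB.pos x (by simpa using hx)⟩,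
      fun g hg X hX Y _ => h.invariant_of_trace hq hg hX⟩, h.symmetriesAreIsometries hq,
      (isLeviCivita_nablaBar_iff B).2 (h.isNaturallyReductive hq)⟩

end

end SO5

end

theorem mainTheorem3 :
    (∀ B : LinearMap.BilinForm ℝ SO5.so5,
      (SO5.IsInner B ∧ SO5.OrthogonalComponents B ∧ SO5.AdInvariant B) ↔
        ∃ (q₁ : LinearMap.BilinForm ℝ (SO5.comp 0)) (t u v w : ℝ),
          SO5.IsInner q₁ ∧ 0 < 4 * t ^ 2 - u ^ 2 ∧ 0 < t ∧ 0 < v ∧ 0 < w ∧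
            SO5.HasForm B q₁ t u v w) ∧
    (∀ (B : LinearMap.BilinForm ℝ SO5.so5) (q₁ : LinearMap.BilinForm ℝ (SO5.comp 0))
      (t u v w : ℝ),
      SO5.IsInner q₁ → 0 < 4 * t ^ 2 - u ^ 2 → 0 < t → 0 < v → 0 < w →
        SO5.HasForm B q₁ t u v w →
          (SO5.IsAdapted B ↔ u = 0 ∧ t = v ∧ v = w)) := by
  refine ⟨fun B => ⟨fun ⟨h1, h2, h3⟩ => SO5.exists_hasForm h1 h2 h3, ?_⟩,
    fun B q₁ t u v w hq htu ht hv hw h => h.isAdapted_iff hq htu ht hv hw⟩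
  rintro ⟨q₁, t, u, v, w, hq, htu, ht, hv, hw, h⟩
  exact ⟨h.isInner hq htu ht hv hw, h.orthogonalComponents hq, h.adInvariant hq⟩
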